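/- Let $(\Omega,\mathcal F,\mathbb P)$ be a probability space and $L^0$ the space of random variables (identified when almost surely equal) with the almost sure order and convergence in probability; write $X^-=\max\{-X,0\}$. Let $\mathcal X$ be either $L^\infty$ with the weak-star topology $\sigma(L^\infty,L^1)$, or a linear subspace of $L^0$ carrying a topology that makes it a Fréchet lattice (a completely metrizable, locally solid Riesz space), such that: $X_n\downarrow 0$ a.s. with $X_n\in\mathcal X$ implies $X_n\to0$ in $\mathcal X$; $L^\infty\subset\mathcal X\subset L^0$ with both inclusions dense and continuous (with the sup-norm on $L^\infty$); and $1_A\mathcal X\subset\mathcal X$ for all $A\in\mathcal F$. For $A\in\mathcal F$ put $\mathcal X(A)=1_A\mathcal X$, and let $\mathcal X_\pm(A)$ be the set of its nonnegative, respectively nonpositive, elements. An acceptance set is a nonempty proper subset $\mathcal A\subset\mathcal X$ such that $X\in\mathcal A$, $Y\in\mathcal X$, $Y\ge X$ imply $Y\in\mathcal A$. It is surplus invariant if $X\in\mathcal A$, $Y\in\mathcal X$, $Y^-\le X^-$ imply $Y\in\mathcal A$. A standard decomposition of $\mathcal A$ is a representation $$\mathcal A=\mathcal X_+(A)\oplus(\mathcal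 X_+(B)+\mathcal D_B)\oplus\mathcal X(C),$$ where $\{A,B,C\}$ is a measurable partition of $\Omega$ (empty pieces allowed) with $\mathbb P(C)<1$, and $\mathcal D_B\subset\mathcal X_-(B)$ is closed, convex, solid ($X\in\mathcal D_B$, $Y\in\mathcal X$, $X\le Y\le 0$ imply $Y\in\mathcal D_B$), tight (for every $\varepsilon\in(0,1)$ there is $M>0$ with $\mathbb P(-M<X<M)>\varepsilon$ for all $X\in\mathcal D_B$), and such that for every measurable $E\subset B$ with $\mathbb P(E)>0$ there is $X\in\mathcal D_B$ with $\mathbb P(1_EX<0)>0$. For $\alpha\in(0,1)$ let $$\mathrm{VaR}_\alpha(X)=\inf\{t\in\mathbb R:\mathbb P(X+t<0)\le\alpha\},\qquad \mathrm{ES}_\alpha(X)=\frac1\alpha\int_0^\alpha\mathrm{VaR}_\beta(X)\,d\beta .$$ **Theorem.** Let $\mathcal A\subset\mathcal X$ be a closed, convex, surplus-invariant acceptance set. Then $\mathcal A$ has a standard decomposition, and for every standard decomposition of $\mathcal A$, with sets $A,B,C,\mathcal D_B$ as above, there exists $X^*\in L^0$, $X^*\le0$, such that $$\mathrm{VaR}_\alpha(1_BX)\le\mathrm{VaR}_\alpha(X^*)\qquad\text{for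 all }X\in\mathcal A,\ \alpha\in(0,1).$$ Moreover, whenever $X^*\in L^0$ with $X^*\le0$ satisfies these inequalities and $X^*\in L^1$, then for all $X\in\mathcal A$ and $\alpha\in(0,1)$ the integrals defining $\mathrm{ES}_\alpha(1_BX)$ and $\mathrm{ES}_\alpha(X^*)$ converge and $$\mathrm{ES}_\alpha(1_BX)\le\mathrm{ES}_\alpha(X^*).$$ -/

import Mathlib

open MeasureTheory Set Filter
open scoped Topology ENNReal Pointwise

namespace SurplusInvariance

variable {Ω : Type*} [MeasurableSpace Ω]

/-- `L⁰`: random variables modulo almost sure equality, with the almost sure order. -/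
abbrev LZero (P : Measure Ω) : Type _ := Ω →ₘ[P] ℝ

section Ambient

variable (P : Measure Ω) (𝒳 : Submodule ℝ (LZero P))

/-- The topology on `𝒳` induced by the functionals `X ↦ E[X Z]`, `Z ∈ L¹`; for `𝒳 = L^∞` this is
the weak-star topology `σ(L^∞, L¹)`. -/
@[reducible] noncomputable def weakStarTopology : TopologicalSpace 𝒳 :=
  TopologicalSpace.induced
    (fun (X : 𝒳) (Z : Lp ℝ 1 P) => ∫ ω, (X : LZero P) ω * Z ω ∂P) inferInstance

/-- `𝒳` is a Fréchet lattice of random variables (a completely metrizable topological vector space,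
closed under absolute values, with a base of solid neighbourhoods of zero) having the σ-Lebesgue
property, dense continuous embeddings `L^∞ ↪ 𝒳 ↪ L⁰` (sup-norm on `L^∞`, convergence in probability
on `L⁰`), and stable under multiplication by indicators. -/
structure IsFrechetAmbient [TopologicalSpace 𝒳] : Prop where
  continuousAdd : ContinuousAdd 𝒳
  continuousSMul : ContinuousSMul ℝ 𝒳
  completelyMetrizable : TopologicalSpace.IsCompletelyMetrizableSpace 𝒳
  abs_mem : ∀ X ∈ 𝒳, |X| ∈ 𝒳
  locallySolid : (𝓝 (0 : 𝒳)).HasBasis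
    (fun U : Set 𝒳 => U ∈ 𝓝 (0 : 𝒳) ∧
      ∀ X ∈ U, ∀ Y : 𝒳, |(Y : LZero P)| ≤ |(X : LZero P)| → Y ∈ U) id
  sigmaLebesgue : ∀ X : ℕ → 𝒳, Antitone X →
    (∀ᵐ ω ∂P, Tendsto (fun n => (X n : LZero P) ω) atTop (𝓝 0)) →
      Tendsto X atTop (𝓝 0)
  embedLinfty : ∃ h : ∀ f : Lp ℝ ∞ P, (f : LZero P) ∈ 𝒳,
    Continuous (fun f : Lp ℝ ∞ P => (⟨f, h f⟩ : 𝒳)) ∧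
      DenseRange (fun f : Lp ℝ ∞ P => (⟨f, h f⟩ : 𝒳))
  embedLZero_continuous : ∀ X : 𝒳,
    TendstoInMeasure P (fun (Y : 𝒳) => ((Y : LZero P) : Ω → ℝ)) (𝓝 X) ((X : LZero P) : Ω → ℝ)
  embedLZero_dense : ∀ f : LZero P, ∃ X : ℕ → 𝒳,
    TendstoInMeasure P (fun n => ((X n : LZero P) : Ω → ℝ)) atTop f
  localization : ∀ A : Set Ω, MeasurableSet A → ∀ X ∈ 𝒳, ∃ Y ∈ 𝒳, (Y : Ω → ℝ) =ᵐ[P] A.indicator X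

/-- Admissible ambient spaces: `L^∞` with the weak-star topology, or a Fréchet lattice of random
variables as above. -/
def IsAmbientSpace [τ : TopologicalSpace 𝒳] : Prop :=
  ((𝒳 : Set (LZero P)) = (Lp ℝ ∞ P : Set (LZero P)) ∧ τ = weakStarTopology P 𝒳) ∨
    IsFrechetAmbient P 𝒳

end Ambient

variable {P : Measure Ω} {𝒳 : Submodule ℝ (LZero P)}

/-- A nonempty, strict, monotone subset of `𝒳`. -/
structure IsAcceptanceSet (𝒜 : Set 𝒳) : Prop where
  nonempty : 𝒜.Nonempty
  strict : 𝒜 ≠ univ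
  monotone : ∀ X ∈ 𝒜, ∀ Y : 𝒳, (X : LZero P) ≤ (Y : LZero P) → Y ∈ 𝒜

/-- Acceptability does not depend on the surplus `X⁺`, only on the default profile `X⁻`. -/
def IsSurplusInvariant (𝒜 : Set 𝒳) : Prop :=
  ∀ X ∈ 𝒜, ∀ Y : 𝒳, (Y : LZero P)⁻ ≤ (X : LZero P)⁻ → Y ∈ 𝒜

variable (𝒳) in
/-- `𝒳(A) = 1_A 𝒳`. -/
def localSpace (A : Set Ω) : Set 𝒳 :=
  {Y | ∃ X : 𝒳, ((Y : LZero P) : Ω → ℝ) =ᵐ[P] A.indicator (X : LZero P)}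

variable (𝒳) in
/-- `𝒳₊(A)`. -/
def posLocalSpace (A : Set Ω) : Set 𝒳 :=
  {Y | Y ∈ localSpace 𝒳 A ∧ (0 : LZero P) ≤ (Y : LZero P)}

variable (𝒳) in
/-- `𝒳₋(A)`. -/
def negLocalSpace (A : Set Ω) : Set 𝒳 :=
  {Y | Y ∈ localSpace 𝒳 A ∧ (Y : LZero P) ≤ (0 : LZero P)}

/-- Solidity in the negative cone `𝒳₋`. -/
def IsSolidNeg (D : Set 𝒳) : Prop :=
  ∀ X ∈ D, ∀ Y : 𝒳, (X : LZero P) ≤ (Y : LZero P) → (Y : LZero P) ≤ 0 → Y ∈ D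

/-- Tightness, i.e. boundedness in probability. -/
def IsTight (D : Set 𝒳) : Prop :=
  ∀ ε : ℝ, 0 < ε → ε < 1 → ∃ M : ℝ, 0 < M ∧
    ∀ X ∈ D, ε < P.real {ω | -M < (X : LZero P) ω ∧ (X : LZero P) ω < M}

/-- `𝒜 = 𝒳₊(A) ⊕ (𝒳₊(B) + D) ⊕ 𝒳(C)` is a standard decomposition of `𝒜`. The sums are Minkowski
sums; directness of `⊕` is automatic, since the summands live on disjoint sets. -/
structure IsStandardDecomposition [TopologicalSpace 𝒳] (𝒜 : Set 𝒳) (A B C : Set Ω) (D : Set 𝒳) :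
    Prop where
  measurable_A : MeasurableSet A
  measurable_B : MeasurableSet B
  measurable_C : MeasurableSet C
  disjoint_AB : Disjoint A B
  disjoint_AC : Disjoint A C
  disjoint_BC : Disjoint B C
  union_eq : A ∪ B ∪ C = univ
  prob_C_lt_one : P C < 1
  subset_neg : D ⊆ negLocalSpace 𝒳 B
  closed : IsClosed D
  convex : Convex ℝ D
  solid : IsSolidNeg D
  tight : IsTight D
  sensitive : ∀ E : Set Ω, MeasurableSet E → E ⊆ B → 0 < P E →
    ∃ X ∈ D, 0 < P {ω | E.indicator (X : LZero P) ω < 0}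
  eq_sum : 𝒜 = posLocalSpace 𝒳 A + (posLocalSpace 𝒳 B + D) + localSpace 𝒳 C

/-- Value-at-Risk `VaR_α(X) = inf {t ∈ ℝ ; P(X + t < 0) ≤ α}`. -/
noncomputable def valueAtRisk (P : Measure Ω) (α : ℝ) (X : Ω → ℝ) : ℝ :=
  sInf {t : ℝ | P.real {ω | X ω + t < 0} ≤ α}

/-- Expected Shortfall `ES_α(X) = (1/α) ∫₀^α VaR_β(X) dβ`, meaningful when
`HasExpectedShortfall P α X`. -/
noncomputable def expectedShortfall (P : Measure Ω) (α : ℝ) (X : Ω → ℝ) : ℝ :=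
  (1 / α) * ∫ β in (0 : ℝ)..α, valueAtRisk P β X

/-- The integral defining the Expected Shortfall converges. -/
def HasExpectedShortfall (P : Measure Ω) (α : ℝ) (X : Ω → ℝ) : Prop :=
  IntervalIntegrable (fun β => valueAtRisk P β X) volume 0 α

/-- `VaR_α(1_B X) ≤ VaR_α(X*)` for all `X ∈ 𝒜` and all `α ∈ (0,1)`. -/
def IsVaRBound (𝒜 : Set 𝒳) (B : Set Ω) (Xstar : LZero P) : Prop :=
  ∀ X ∈ 𝒜, ∀ α ∈ Ioo (0 : ℝ) 1,
    valueAtRisk P α (B.indicator (X : LZero P)) ≤ valueAtRisk P α Xstar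

end SurplusInvariance

/-! By surplus invariance everything is determined by the losses `f = -X ≥ 0` with `X ∈ 𝒜`, `X ≤ 0`.
They form a convex solid family, closed under bounded a.s. limits. Let `S` be the largest set on
which it is bounded in probability. Off `S` every bounded loss is acceptable
(`exists_isTightOn_and_compl`): a functional `Z ∈ L²` separating such a loss from the family is
bounded above on the family, which is therefore tight on each `{Z ≥ δ}`. Hence `{Z > 0} ⊆ S` up to
null sets, and `Z` cannot separate a loss supported off `S`. Convexity and closedness then make
positions on `C = Sᶜ` irrelevant to acceptance (`mem_of_ae_off`). With `U` the largest set charged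
by acceptable losses, take `B = S ∩ U`, `A = S \ U` and `D = 𝒜 ∩ 𝒳₋(B)`.

For the VaR bound, tightness of `D` makes `q(α) = sup VaR_α(1_B X)` over `X ∈ 𝒜` finite for each
`α`, and `q` is antitone. `exists_valueAtRisk_ge` builds `X*` with `VaR_α(X*) ≥ q(α)` without
assuming that the probability space is atomless, by summing large losses over small events. The ES
bound follows by integrating in the level, once the quantile function of an integrable `X*` is known
to be integrable. -/

namespace SurplusInvariance

/-! ### Boundedness in probability and the Brannath–Schachermayer splitting. -/

variable {Ω : Type*} [MeasurableSpace Ω] {P : Measure Ω}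

/-- A nonempty family of measurable sets that is stable under countable unions has a largest member
up to null sets. -/
theorem exists_maximal_of_iUnion_mem [IsFiniteMeasure P] (F : Set (Set Ω))
    (hne : F.Nonempty) (hmeas : ∀ S ∈ F, MeasurableSet S)
    (hU : ∀ s : ℕ → Set Ω, (∀ n, s n ∈ F) → ⋃ n, s n ∈ F) :
    ∃ S ∈ F, ∀ T ∈ F, P (T \ S) = 0 := by
  obtain ⟨u, -, hu, huF⟩ := exists_seq_tendsto_sSup (hne.image P) (OrderTop.bddAbove _)
  choose s hsF hs using huF
  refine ⟨⋃ n, s n, hU s hsF, fun T hT => ?_⟩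
  have hle : ∀ S ∈ F, P S ≤ P (⋃ n, s n) := fun S hS =>
    (le_sSup (mem_image_of_mem P hS)).trans <| le_of_tendsto' hu fun n => by
      rw [← hs n]; exact measure_mono (subset_iUnion s n)
  -- Prepending `T` to the sequence keeps the union in `F`, so adding `T` cannot increase a measure
  -- that is already maximal.
  have hUT : T ∪ ⋃ n, s n ∈ F := by
    convert hU (fun n => Nat.casesOn n T s) (fun n => by cases n <;> simp [hT, hsF]) using 1
    ext x
    simp only [mem_union, mem_iUnion]
    constructor
    · rintro (h | ⟨n, h⟩)
      · exact ⟨0, h⟩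
      · exact ⟨n + 1, h⟩
    · rintro ⟨n | n, h⟩
      · exact Or.inl h
      · exact Or.inr ⟨n, h⟩
  have h1 := hle _ hUT
  have h2 : P (T ∪ ⋃ n, s n) = P (T \ ⋃ n, s n) + P (⋃ n, s n) := by
    rw [← sdiff_union_self, measure_union disjoint_sdiff_left (hmeas _ (hU s hsF))]
  rw [h2] at h1
  by_contra h0
  have := ENNReal.lt_add_right (measure_ne_top P (⋃ n, s n)) h0
  rw [add_comm] at this
  exact absurd h1 (not_le.2 this)

/-- `T` is bounded in probability on `S`. -/
def IsTightOn (T : Set (LZero P)) (S : Set Ω) : Prop :=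
  ∀ ε : ℝ≥0∞, ε ≠ 0 → ∃ M : ℝ, 0 < M ∧ ∀ f ∈ T, P (S ∩ {ω | M ≤ f ω}) ≤ ε

theorem IsTightOn.union {T : Set (LZero P)} {S S' : Set Ω} (h : IsTightOn T S)
    (h' : IsTightOn T S') : IsTightOn T (S ∪ S') := by
  intro ε hε
  obtain ⟨M, hM, H⟩ := h (ε / 2) (by simpa using hε)
  obtain ⟨M', hM', H'⟩ := h' (ε / 2) (by simpa using hε)
  refine ⟨max M M', lt_max_of_lt_left hM, fun f hf => ?_⟩
  rw [union_inter_distrib_right]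
  refine (measure_union_le _ _).trans ?_
  rw [← ENNReal.add_halves ε]
  refine add_le_add ((measure_mono ?_).trans (H f hf)) ((measure_mono ?_).trans (H' f hf))
  · exact inter_subset_inter_right _ fun ω (hω : max M M' ≤ f ω) => (le_max_left _ _).trans hω
  · exact inter_subset_inter_right _ fun ω (hω : max M M' ≤ f ω) => (le_max_right _ _).trans hω

/-- Finitely many pieces carry all but `ε / 2` of the mass of the union, and this remainder does not
depend on `f`. -/
theorem IsTightOn.iUnion [IsFiniteMeasure P] {T : Set (LZero P)} {s : ℕ → Set Ω}
    (hs : ∀ n, MeasurableSet (s n)) (h : ∀ n, IsTightOn T (s n)) : IsTightOn T (⋃ n, s n) := by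
  have hacc : ∀ n, IsTightOn T (accumulate s n) := by
    intro n
    induction n with
    | zero => rw [accumulate_zero_nat]; exact h 0
    | succ n ih => rw [accumulate_succ]; exact ih.union (h _)
  have hm : ∀ n, MeasurableSet (accumulate s n) := fun n =>
    MeasurableSet.biUnion (to_countable _) fun i _ => hs i
  intro ε hε
  have ht : Tendsto (fun n => P ((⋃ n, s n) \ accumulate s n)) atTop (𝓝 0) := by
    have hd := tendsto_measure_iInter_atTop (μ := P)
      (s := fun n => (⋃ n, s n) \ accumulate s n)
      (fun n => ((MeasurableSet.iUnion hs).diff (hm n)).nullMeasurableSet)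
      (fun m n hmn => sdiff_subset_sdiff_right (monotone_accumulate hmn))
      ⟨0, measure_ne_top _ _⟩
    rwa [← sdiff_iUnion, iUnion_accumulate, sdiff_self, measure_empty] at hd
  obtain ⟨N, hN⟩ := (ht.eventually_lt_const
    (show (0 : ℝ≥0∞) < ε / 2 by simpa [pos_iff_ne_zero] using hε)).exists
  obtain ⟨M, hM, H⟩ := hacc N (ε / 2) (by simpa using hε)
  refine ⟨M, hM, fun f hf => ?_⟩
  rw [← ENNReal.add_halves ε]
  refine (measure_mono (t := accumulate s N ∩ {ω | M ≤ f ω} ∪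
    (⋃ n, s n) \ accumulate s N) ?_).trans
    ((measure_union_le _ _).trans (add_le_add (H f hf) hN.le))
  rintro ω ⟨h1, h2⟩
  by_cases h3 : ω ∈ accumulate s N
  · exact Or.inl ⟨h3, h2⟩
  · exact Or.inr ⟨h1, h3⟩

/-- A bounded random variable that is an `L²`-limit of elements of `T` belongs to `T`. -/
theorem mem_of_mem_closure_L2 {T : Set (LZero P)}
    (hpos : ∀ f ∈ T, ∀ᵐ ω ∂P, 0 ≤ f ω)
    (hsolid : ∀ f ∈ T, ∀ (g : LZero P) (M : ℝ),
      (∀ᵐ ω ∂P, 0 ≤ g ω ∧ g ω ≤ f ω ∧ g ω ≤ M) → g ∈ T)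
    (hclosed : ∀ u : ℕ → LZero P, (∀ n, u n ∈ T) → ∀ M : ℝ, (∀ n, ∀ᵐ ω ∂P, u n ω ≤ M) →
      ∀ f : LZero P, (∀ᵐ ω ∂P, Tendsto (fun n => u n ω) atTop (𝓝 (f ω))) → f ∈ T)
    (f : Lp ℝ 2 P) (M : ℝ) (hM : ∀ᵐ ω ∂P, f ω ≤ M)
    (hf : f ∈ closure {g : Lp ℝ 2 P | (g : LZero P) ∈ T}) : (f : LZero P) ∈ T := by
  obtain ⟨v, hvT, hv⟩ := mem_closure_iff_seq_limit.1 hf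
  obtain ⟨ns, -, hns⟩ := (tendstoInMeasure_of_tendsto_Lp hv).exists_seq_tendsto_ae
  have hvpos : ∀ᵐ ω ∂P, ∀ n, 0 ≤ v n ω := ae_all_iff.2 fun n => hpos _ (hvT n)
  have hinf : ∀ᵐ ω ∂P, ∀ n, ((v (ns n) : LZero P) ⊓ (f : LZero P)) ω = v (ns n) ω ⊓ f ω :=
    ae_all_iff.2 fun n => AEEqFun.coeFn_inf _ _
  have hfpos : ∀ᵐ ω ∂P, 0 ≤ f ω := by
    filter_upwards [hns, hvpos] with ω h1 h2
    exact ge_of_tendsto' h1 fun n => h2 _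
  -- Truncating at `f` itself keeps the sequence in `T` by solidity, bounds it by `M`, and does not
  -- change the limit.
  refine hclosed (fun n => (v (ns n) : LZero P) ⊓ (f : LZero P)) (fun n => ?_) M (fun n => ?_) _ ?_
  · refine hsolid _ (hvT (ns n)) _ M ?_
    filter_upwards [hinf, hfpos, hvpos, hM] with ω h1 h2 h3 h4
    rw [h1]
    exact ⟨le_inf (h3 _) h2, inf_le_left, inf_le_right.trans h4⟩
  · filter_upwards [hinf, hM] with ω h1 h4
    rw [h1]
    exact inf_le_right.trans h4
  · filter_upwards [hns, hinf] with ω h1 h2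
    simp only [h2]
    simpa using h1.inf_nhds (tendsto_const_nhds (x := f ω))

/-- A family on which `Z` acts as a bounded functional is bounded in probability on `{Z ≥ δ}`. -/
theorem isTightOn_of_inner_le [IsFiniteMeasure P] {T : Set (LZero P)}
    (hpos : ∀ f ∈ T, ∀ᵐ ω ∂P, 0 ≤ f ω)
    (hsolid : ∀ f ∈ T, ∀ (g : LZero P) (M : ℝ),
      (∀ᵐ ω ∂P, 0 ≤ g ω ∧ g ω ≤ f ω ∧ g ω ≤ M) → g ∈ T)
    (Z : Lp ℝ 2 P) (c : ℝ) (hc : 0 ≤ c)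
    (hZ : ∀ f : Lp ℝ 2 P, (f : LZero P) ∈ T → inner ℝ f Z ≤ c) {δ : ℝ} (hδ : 0 < δ) :
    IsTightOn T {ω | δ ≤ Z ω} := by
  have key : ∀ f ∈ T, ∀ M : ℝ, 0 < M →
      P.real ({ω | δ ≤ Z ω} ∩ {ω | M ≤ f ω}) ≤ c / (M * δ) := by
    intro f hf M hM
    set E := {ω | δ ≤ Z ω} ∩ {ω | M ≤ f ω} with hE
    have hEm : MeasurableSet E :=
      (measurableSet_le measurable_const (Lp.stronglyMeasurable Z).measurable).inter
        (measurableSet_le measurable_const f.stronglyMeasurable.measurable)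
    -- Markov's inequality is run on `M · 1_E ≤ f`, because `f` need not be in `L²`.
    have hmem : (indicatorConstLp 2 hEm (measure_ne_top P E) M : LZero P) ∈ T := by
      refine hsolid f hf _ M ?_
      filter_upwards [indicatorConstLp_coeFn (p := 2) (hs := hEm) (hμs := measure_ne_top P E)
        (c := M), hpos f hf] with ω h1 h2
      rw [h1]
      by_cases hω : ω ∈ E
      · simp only [indicator_of_mem hω]
        exact ⟨hM.le, hω.2, le_rfl⟩
      · simp only [indicator_of_notMem hω]
        exact ⟨le_rfl, h2, hM.le⟩
    have h1 := hZ _ hmem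
    rw [L2.inner_indicatorConstLp_eq_inner_setIntegral] at h1
    have hint : Integrable Z P := (Lp.memLp Z).integrable (by norm_num)
    have h2 : δ * P.real E ≤ ∫ ω in E, Z ω ∂P := by
      have := setIntegral_mono_on (μ := P) (f := fun _ => δ) (g := Z) (s := E)
        (integrable_const _) hint.integrableOn hEm (fun ω hω => hω.1)
      rwa [setIntegral_const, smul_eq_mul, mul_comm] at this
    rw [le_div_iff₀ (by positivity)]
    have h3 : inner ℝ M (∫ ω in E, Z ω ∂P) = (∫ ω in E, Z ω ∂P) * M := rfl
    rw [h3] at h1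
    nlinarith
  intro ε hε
  obtain ⟨e, he, heε⟩ : ∃ e : ℝ, 0 < e ∧ ENNReal.ofReal e ≤ ε := by
    rcases eq_or_ne ε ∞ with rfl | h
    · exact ⟨1, one_pos, le_top⟩
    · exact ⟨ε.toReal, ENNReal.toReal_pos hε h, ENNReal.ofReal_toReal_le⟩
  -- This choice turns `c / (M * δ)` into `c * e / (c + 1) ≤ e`; the `+ 1` keeps `M` positive when
  -- `c = 0`.
  refine ⟨(c + 1) / (e * δ), by positivity, fun f hf => le_trans ?_ heε⟩
  rw [← ENNReal.ofReal_toReal (measure_ne_top P _)]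
  refine ENNReal.ofReal_le_ofReal ((key f hf _ (by positivity)).trans ?_)
  rw [div_le_iff₀ (by positivity)]
  field_simp
  linarith

/-- Brannath–Schachermayer type decomposition: a convex solid family of nonnegative random variables
that is closed under bounded almost sure limits is bounded in probability on some set, and contains
all bounded nonnegative random variables supported on its complement. -/
theorem exists_isTightOn_and_compl [IsFiniteMeasure P] {T : Set (LZero P)} (h0 : 0 ∈ T)
    (hconv : Convex ℝ T)
    (hpos : ∀ f ∈ T, ∀ᵐ ω ∂P, 0 ≤ f ω)
    (hsolid : ∀ f ∈ T, ∀ (g : LZero P) (M : ℝ),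
      (∀ᵐ ω ∂P, 0 ≤ g ω ∧ g ω ≤ f ω ∧ g ω ≤ M) → g ∈ T)
    (hclosed : ∀ u : ℕ → LZero P, (∀ n, u n ∈ T) → ∀ M : ℝ, (∀ n, ∀ᵐ ω ∂P, u n ω ≤ M) →
      ∀ f : LZero P, (∀ᵐ ω ∂P, Tendsto (fun n => u n ω) atTop (𝓝 (f ω))) → f ∈ T) :
    ∃ S : Set Ω, MeasurableSet S ∧ IsTightOn T S ∧
      ∀ (g : LZero P) (M : ℝ), (∀ᵐ ω ∂P, 0 ≤ g ω ∧ g ω ≤ M ∧ (ω ∈ S → g ω = 0)) → g ∈ T := by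
  obtain ⟨S, ⟨hSm, hSt⟩, hmax⟩ := exists_maximal_of_iUnion_mem (P := P)
    {S | MeasurableSet S ∧ IsTightOn T S}
    ⟨∅, MeasurableSet.empty, fun ε hε => ⟨1, one_pos, fun f hf => by simp⟩⟩
    (fun S hS => hS.1)
    (fun s hs => ⟨MeasurableSet.iUnion fun n => (hs n).1,
      IsTightOn.iUnion (fun n => (hs n).1) fun n => (hs n).2⟩)
  refine ⟨S, hSm, hSt, fun g M hg => ?_⟩
  have hgL : g ∈ Lp ℝ 2 P := Lp.mem_Lp_of_ae_bound M (by
    filter_upwards [hg] with ω h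
    rw [Real.norm_eq_abs, abs_of_nonneg h.1]
    exact h.2.1)
  let g' : Lp ℝ 2 P := ⟨g, hgL⟩
  refine mem_of_mem_closure_L2 hpos hsolid hclosed g' M (hg.mono fun ω h => h.2.1) ?_
  by_contra hcl
  have hK : Convex ℝ {g : Lp ℝ 2 P | (g : LZero P) ∈ T} := fun x hx y hy a b ha hb hab =>
    hconv hx hy ha hb hab
  obtain ⟨φ, u, hφ, hu⟩ := geometric_hahn_banach_closed_point hK.closure isClosed_closure hcl
  set Z : Lp ℝ 2 P := (InnerProductSpace.toDual ℝ _).symm φ with hZdef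
  have hZ : ∀ f, inner ℝ f Z = φ f := fun f => by
    rw [real_inner_comm]; exact InnerProductSpace.toDual_symm_apply
  have hu0 : 0 < u := by
    have := hφ 0 (subset_closure h0)
    rwa [map_zero] at this
  -- Each `{Z ≥ 1 / (n + 1)}` is a tight set, hence almost contained in the maximal `S`.
  have hnull : P ({ω | 0 < Z ω} \ S) = 0 := by
    have h1 : ∀ n : ℕ, P ({ω | 1 / ((n : ℝ) + 1) ≤ Z ω} \ S) = 0 := fun n =>
      hmax _ ⟨measurableSet_le measurable_const (Lp.stronglyMeasurable Z).measurable,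
        isTightOn_of_inner_le hpos hsolid Z u hu0.le
          (fun f hf => by rw [hZ]; exact (hφ f (subset_closure hf)).le) (by positivity)⟩
    refine measure_mono_null ?_ (measure_iUnion_null h1)
    rintro ω ⟨h2, h3⟩
    obtain ⟨n, hn⟩ := exists_nat_one_div_lt (show 0 < Z ω from h2)
    exact mem_iUnion.2 ⟨n, hn.le, h3⟩
  have : φ g' ≤ 0 := by
    rw [← hZ, L2.inner_def]
    refine integral_nonpos_of_ae ?_
    have h4 : ∀ᵐ ω ∂P, ¬ (0 < Z ω ∧ ω ∉ S) := measure_eq_zero_iff_ae_notMem.1 hnull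
    filter_upwards [hg, h4] with ω h5 h6
    change Z ω * g ω ≤ 0
    by_cases hω : ω ∈ S
    · rw [h5.2.2 hω, mul_zero]
    · exact mul_nonpos_of_nonpos_of_nonneg (not_lt.1 fun h => h6 ⟨h, hω⟩) h5.1
  linarith

end SurplusInvariance

/-! ### Common properties of the two kinds of ambient space. -/

namespace SurplusInvariance

variable {Ω : Type*} [MeasurableSpace Ω] {P : Measure Ω} {𝒳 : Submodule ℝ (LZero P)}

variable (P 𝒳) in
/-- The order-theoretic and topological features shared by all admissible ambient spaces. -/
structure IsOrderRegular [TopologicalSpace 𝒳] : Prop where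
  bounded_mem : ∀ (f : LZero P) (M : ℝ), (∀ᵐ ω ∂P, |f ω| ≤ M) → f ∈ 𝒳
  abs_mem : ∀ X ∈ 𝒳, |X| ∈ 𝒳
  localization : ∀ A : Set Ω, MeasurableSet A → ∀ X ∈ 𝒳, ∃ Y ∈ 𝒳, (Y : Ω → ℝ) =ᵐ[P] A.indicator X
  tendsto_of_dominated : ∀ (Y : ℕ → 𝒳) (Z : 𝒳) (W : ℕ → 𝒳),
    (∀ᵐ ω ∂P, Antitone fun n => (W n : LZero P) ω) →
    (∀ᵐ ω ∂P, Tendsto (fun n => (W n : LZero P) ω) atTop (𝓝 0)) →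
    (∀ᵐ ω ∂P, ∀ n, |(Y n : LZero P) ω - (Z : LZero P) ω| ≤ (W n : LZero P) ω) →
    Tendsto Y atTop (𝓝 Z)
  isClosed_negLocalSpace : ∀ B : Set Ω, MeasurableSet B → IsClosed (negLocalSpace 𝒳 B)

theorem mem_negLocalSpace_iff {B : Set Ω} {Y : 𝒳} :
    Y ∈ negLocalSpace 𝒳 B ↔
      ∀ᵐ ω ∂P, (Y : LZero P) ω ≤ 0 ∧ (ω ∉ B → (Y : LZero P) ω = 0) := by
  constructor
  · rintro ⟨⟨X, hX⟩, hY⟩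
    filter_upwards [hX, AEEqFun.coeFn_le.2 hY, AEEqFun.coeFn_zero (α := Ω) (β := ℝ) (μ := P)]
      with ω h1 h2 h3
    refine ⟨by simpa [h3] using h2, fun h => by rw [h1, indicator_of_notMem h]⟩
  · intro h
    refine ⟨⟨Y, ?_⟩, AEEqFun.coeFn_le.1 ?_⟩
    · filter_upwards [h] with ω h1
      by_cases hω : ω ∈ B
      · rw [indicator_of_mem hω]
      · rw [indicator_of_notMem hω, h1.2 hω]
    · filter_upwards [h, AEEqFun.coeFn_zero (α := Ω) (β := ℝ) (μ := P)] with ω h1 h3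
      rw [h3]
      exact h1.1

/-- Dominated convergence combines the σ-Lebesgue property with solid neighbourhoods; closedness of
the negative cones comes from the continuous embedding into `L⁰`. -/
theorem IsFrechetAmbient.isOrderRegular [IsProbabilityMeasure P] [TopologicalSpace 𝒳]
    (h : IsFrechetAmbient P 𝒳) : IsOrderRegular P 𝒳 where
  bounded_mem f M hf := by
    obtain ⟨h1, -⟩ := h.embedLinfty
    exact h1 ⟨f, Lp.mem_Lp_of_ae_bound M hf⟩
  abs_mem := h.abs_mem
  localization := h.localization
  tendsto_of_dominated Y Z W hW hW0 hY := by
    have := h.continuousAdd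
    have h1 : Tendsto W atTop (𝓝 0) := by
      refine h.sigmaLebesgue W (fun m n hmn => ?_) hW0
      refine AEEqFun.coeFn_le.1 (show (W n : LZero P) ≤ᵐ[P] (W m : LZero P) from ?_)
      filter_upwards [hW] with ω h2 using h2 hmn
    have h2 : Tendsto (fun n => Y n - Z) atTop (𝓝 0) := by
      refine h.locallySolid.tendsto_right_iff.2 fun U hU => ?_
      filter_upwards [h1 hU.1] with n hn
      refine hU.2 _ hn _ (AEEqFun.coeFn_le.1 ?_)
      filter_upwards [hY, AEEqFun.coeFn_abs ((Y n - Z : 𝒳) : LZero P),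
        AEEqFun.coeFn_abs (W n : LZero P), AEEqFun.coeFn_sub (Y n : LZero P) (Z : LZero P)]
        with ω h3 h4 h5 h6
      rw [h4, h5]
      change |((Y n : LZero P) - (Z : LZero P)) ω| ≤ _
      rw [h6]
      exact (h3 n).trans (le_abs_self _)
    simpa using h2.add (tendsto_const_nhds (x := Z))
  isClosed_negLocalSpace B hB := by
    refine isClosed_of_closure_subset fun X hX => ?_
    have hm := tendstoInMeasure_iff_norm.1 (h.embedLZero_continuous X)
    -- On the excluded event `X` differs by at least `ε` from every member of the cone, and some
    -- members are arbitrarily close to `X` in probability.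
    have key : ∀ ε : ℝ, 0 < ε →
        ∀ᵐ ω ∂P, ¬ (ε ≤ (X : LZero P) ω ∨ (ω ∉ B ∧ ε ≤ |(X : LZero P) ω|)) := by
      intro ε hε
      change P {ω | ¬ ¬ _} = 0
      simp only [not_not]
      refine le_antisymm (ENNReal.le_of_forall_pos_le_add fun δ hδ _ => ?_) zero_le
      rw [zero_add]
      have hev := (hm ε hε).eventually_lt_const (show (0 : ℝ≥0∞) < δ by exact_mod_cast hδ)
      obtain ⟨Y, hY1, hY2⟩ := mem_closure_iff_nhds.1 hX _ hev
      refine (measure_mono_ae ?_).trans (le_of_lt hY1)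
      filter_upwards [mem_negLocalSpace_iff.1 hY2] with ω h1 h2
      change ε ≤ ‖_‖
      rw [Real.norm_eq_abs, abs_sub_comm]
      rcases h2 with h2 | ⟨h2, h3⟩
      · exact le_trans (by linarith [h1.1]) (le_abs_self _)
      · rwa [h1.2 h2, sub_zero]
    refine mem_negLocalSpace_iff.2 ?_
    have hall : ∀ᵐ ω ∂P, ∀ n : ℕ, ¬ (1 / ((n : ℝ) + 1) ≤ (X : LZero P) ω ∨
        (ω ∉ B ∧ 1 / ((n : ℝ) + 1) ≤ |(X : LZero P) ω|)) :=
      ae_all_iff.2 fun n => key _ (by positivity)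
    filter_upwards [hall] with ω h1
    refine ⟨?_, fun hω => ?_⟩
    · by_contra! h2
      obtain ⟨n, hn⟩ := exists_nat_one_div_lt h2
      exact h1 n (Or.inl hn.le)
    · by_contra h2
      obtain ⟨n, hn⟩ := exists_nat_one_div_lt (abs_pos.2 h2)
      exact h1 n (Or.inr ⟨hω, hn.le⟩)

theorem exists_ae_abs_le_of_mem_Lp_top {f : LZero P} (hf : f ∈ Lp ℝ ∞ P) :
    ∃ M : ℝ, ∀ᵐ ω ∂P, |f ω| ≤ M := by
  refine ⟨(eLpNorm f ∞ P).toReal, ?_⟩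
  have h1 := ae_le_eLpNormEssSup (f := (f : Ω → ℝ)) (μ := P)
  filter_upwards [h1] with ω h2
  rw [← eLpNorm_exponent_top] at h2
  have := ENNReal.toReal_mono (Lp.mem_Lp_iff_eLpNorm_lt_top.1 hf).ne h2
  simpa using this

/-- Here convergence is tested against each `V ∈ L¹`, where classical dominated convergence applies.
-/
theorem isOrderRegular_weakStar [IsProbabilityMeasure P] [τ : TopologicalSpace 𝒳]
    (h : (𝒳 : Set (LZero P)) = (Lp ℝ ∞ P : Set (LZero P))) (hτ : τ = weakStarTopology P 𝒳) :
    IsOrderRegular P 𝒳 := by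
  have hmem : ∀ f : LZero P, f ∈ 𝒳 ↔ f ∈ Lp ℝ ∞ P := fun f => Set.ext_iff.1 h f
  have hbdd : ∀ (f : LZero P) (M : ℝ), (∀ᵐ ω ∂P, |f ω| ≤ M) → f ∈ 𝒳 := fun f M hf =>
    (hmem f).2 (Lp.mem_Lp_of_ae_bound M hf)
  have hb : ∀ X : 𝒳, ∃ M : ℝ, ∀ᵐ ω ∂P, |(X : LZero P) ω| ≤ M := fun X =>
    exists_ae_abs_le_of_mem_Lp_top ((hmem _).1 X.2)
  have hcont : ∀ Z : Lp ℝ 1 P, Continuous fun X : 𝒳 => ∫ ω, (X : LZero P) ω * Z ω ∂P := by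
    intro Z
    subst hτ
    let := weakStarTopology P 𝒳
    have : Continuous fun (X : 𝒳) (Z : Lp ℝ 1 P) => ∫ ω, (X : LZero P) ω * Z ω ∂P :=
      continuous_induced_dom
    exact continuous_pi_iff.1 this Z
  have hint : ∀ X : 𝒳, Integrable (X : LZero P) P := fun X =>
    let ⟨M, hM⟩ := hb X
    Integrable.of_bound (AEEqFun.aestronglyMeasurable _) M hM
  refine ⟨hbdd, ?_, ?_, ?_, ?_⟩
  · intro X hX
    obtain ⟨M, hM⟩ := hb ⟨X, hX⟩
    refine hbdd _ M ?_
    filter_upwards [hM, AEEqFun.coeFn_abs X] with ω h1 h2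
    rwa [h2, abs_abs]
  · intro A hA X hX
    obtain ⟨M, hM⟩ := hb ⟨X, hX⟩
    refine ⟨AEEqFun.mk (A.indicator X) (X.aestronglyMeasurable.indicator hA), hbdd _ M ?_,
      AEEqFun.coeFn_mk _ _⟩
    filter_upwards [hM, AEEqFun.coeFn_mk (A.indicator X) (X.aestronglyMeasurable.indicator hA)]
      with ω h1 h2
    rw [h2]
    by_cases hω : ω ∈ A
    · rwa [indicator_of_mem hω]
    · rw [indicator_of_notMem hω, abs_zero]
      exact (abs_nonneg _).trans h1
  · intro Y Z W hW hW0 hY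
    subst hτ
    rw [nhds_induced, tendsto_comap_iff, tendsto_pi_nhds]
    intro V
    obtain ⟨M, hM⟩ := hb Z
    obtain ⟨N, hN⟩ := hb (W 0)
    have hV : Integrable V P := L1.integrable_coeFn V
    have hYW : ∀ᵐ ω ∂P, Tendsto (fun n => (Y n : LZero P) ω) atTop (𝓝 ((Z : LZero P) ω)) := by
      filter_upwards [hW0, hY] with ω h1 h2
      rw [tendsto_iff_norm_sub_tendsto_zero]
      exact squeeze_zero (fun _ => norm_nonneg _) h2 h1
    refine tendsto_integral_of_dominated_convergence (fun ω => (M + N) * |V ω|)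
      (fun n => (AEEqFun.aestronglyMeasurable _).mul hV.1) (hV.abs.const_mul _)
      (fun n => ?_) ?_
    · filter_upwards [hW, hY, hM, hN] with ω h1 h2 h3 h4
      rw [norm_mul, Real.norm_eq_abs, Real.norm_eq_abs]
      refine mul_le_mul_of_nonneg_right ?_ (abs_nonneg _)
      have h5 := h2 n
      have h6 := h1 (Nat.zero_le n)
      have h7 := (le_abs_self _).trans h4
      simp only at h6
      rw [abs_le] at h3 h5 ⊢
      constructor <;> linarith [h3.1, h3.2, h5.1, h5.2]
    · filter_upwards [hYW] with ω h1 using h1.mul_const _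
  · intro B hB
    have hset : ∀ E : Set Ω, MeasurableSet E →
        Continuous fun X : 𝒳 => ∫ ω in E, (X : LZero P) ω ∂P := by
      intro E hE
      convert hcont (indicatorConstLp 1 hE (measure_ne_top P E) 1) using 2 with X
      rw [← integral_indicator hE]
      refine integral_congr_ae ?_
      filter_upwards [indicatorConstLp_coeFn (p := 1) (hs := hE) (hμs := measure_ne_top P E)
        (c := (1 : ℝ))] with ω h1
      rw [h1]
      by_cases hω : ω ∈ E <;> simp [hω]
    -- The cone is an intersection of weak-star closed half-spaces given by indicators; off `B` both
    -- signs are imposed, which forces `X = 0` there.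
    have heq : negLocalSpace 𝒳 B = ⋂ E : {E : Set Ω // MeasurableSet E},
        {X : 𝒳 | ∫ ω in (E : Set Ω), (X : LZero P) ω ∂P ≤ 0} ∩
          {X : 𝒳 | 0 ≤ ∫ ω in (E : Set Ω) ∩ Bᶜ, (X : LZero P) ω ∂P} := by
      ext X
      rw [mem_negLocalSpace_iff, mem_iInter]
      constructor
      · rintro hX ⟨E, hE⟩
        refine ⟨setIntegral_nonpos_of_ae (hX.mono fun ω h => h.1), ?_⟩
        change 0 ≤ ∫ ω in E ∩ Bᶜ, (X : LZero P) ω ∂P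
        refine le_of_eq (Eq.symm (setIntegral_eq_zero_of_ae_eq_zero ?_))
        filter_upwards [hX] with ω h1 h2 using h1.2 h2.2
      · intro hX
        have h1 : 0 ≤ᵐ[P] fun ω => - (X : LZero P) ω := by
          refine ae_nonneg_of_forall_setIntegral_nonneg (hint X).neg fun s hs _ => ?_
          rw [integral_neg]
          exact neg_nonneg.2 (hX ⟨s, hs⟩).1
        have h2 : 0 ≤ᵐ[P.restrict Bᶜ] (X : LZero P) := by
          refine ae_nonneg_of_forall_setIntegral_nonneg (hint X).restrict fun s hs _ => ?_
          rw [Measure.restrict_restrict hs]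
          exact (hX ⟨s, hs⟩).2
        have h3 := (ae_restrict_iff' hB.compl).1 h2
        filter_upwards [h1, h3] with ω h4 h5
        simp only [Pi.zero_apply, Left.nonneg_neg_iff] at h4
        exact ⟨h4, fun hω => le_antisymm h4 (h5 hω)⟩
    rw [heq]
    exact isClosed_iInter fun E => (isClosed_le (hset E E.2) continuous_const).inter
      (isClosed_le continuous_const (hset _ (E.2.inter hB.compl)))

theorem IsAmbientSpace.isOrderRegular [IsProbabilityMeasure P] [TopologicalSpace 𝒳]
    (h : IsAmbientSpace P 𝒳) : IsOrderRegular P 𝒳 := by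
  rcases h with ⟨h1, h2⟩ | h
  · exact isOrderRegular_weakStar h1 h2
  · exact h.isOrderRegular

end SurplusInvariance

/-! ### Surplus invariance and irrelevance of the free region. -/

namespace SurplusInvariance

variable {Ω : Type*} [MeasurableSpace Ω] {P : Measure Ω} {𝒳 : Submodule ℝ (LZero P)}

theorem IsSurplusInvariant.mem_of_ae {𝒜 : Set 𝒳} (hsi : IsSurplusInvariant 𝒜) {X Y : 𝒳}
    (hX : X ∈ 𝒜) (h : ∀ᵐ ω ∂P, (Y : LZero P) ω < 0 → (X : LZero P) ω ≤ (Y : LZero P) ω) :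
    Y ∈ 𝒜 := by
  refine hsi X hX Y (AEEqFun.coeFn_le.1 ?_)
  change ((-(Y : LZero P) ⊔ 0 : LZero P) : Ω → ℝ) ≤ᵐ[P] ((-(X : LZero P) ⊔ 0 : LZero P) : Ω → ℝ)
  filter_upwards [h, AEEqFun.coeFn_sup (-(Y : LZero P)) 0, AEEqFun.coeFn_sup (-(X : LZero P)) 0,
    AEEqFun.coeFn_neg (Y : LZero P), AEEqFun.coeFn_neg (X : LZero P),
    AEEqFun.coeFn_zero (α := Ω) (β := ℝ) (μ := P)] with ω h1 h2 h3 h4 h5 h6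
  rw [h2, h3, h4, h5, h6]
  simp only [Pi.neg_apply, Pi.zero_apply]
  refine sup_le ?_ le_sup_right
  by_cases hY : (Y : LZero P) ω < 0
  · exact (neg_le_neg (h1 hY)).trans le_sup_left
  · exact (neg_nonpos.2 (not_lt.1 hY)).trans le_sup_right

theorem coeFn_add_ae (X Y : 𝒳) :
    ∀ᵐ ω ∂P, ((X + Y : 𝒳) : LZero P) ω = (X : LZero P) ω + (Y : LZero P) ω :=
  AEEqFun.coeFn_add (X : LZero P) (Y : LZero P)

theorem coeFn_sub_ae (X Y : 𝒳) :
    ∀ᵐ ω ∂P, ((X - Y : 𝒳) : LZero P) ω = (X : LZero P) ω - (Y : LZero P) ω :=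
  AEEqFun.coeFn_sub (X : LZero P) (Y : LZero P)

theorem coeFn_neg_ae (X : 𝒳) : ∀ᵐ ω ∂P, ((-X : 𝒳) : LZero P) ω = -(X : LZero P) ω :=
  AEEqFun.coeFn_neg (X : LZero P)

theorem coeFn_smul_ae (c : ℝ) (X : 𝒳) :
    ∀ᵐ ω ∂P, ((c • X : 𝒳) : LZero P) ω = c * (X : LZero P) ω :=
  AEEqFun.coeFn_smul c (X : LZero P)

theorem coeFn_zero_ae : ∀ᵐ ω ∂P, ((0 : 𝒳) : LZero P) ω = 0 :=
  AEEqFun.coeFn_zero (α := Ω) (β := ℝ) (μ := P)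

theorem ext_ae {X Y : 𝒳} (h : ∀ᵐ ω ∂P, (X : LZero P) ω = (Y : LZero P) ω) : X = Y :=
  Subtype.ext (AEEqFun.ext h)

namespace IsOrderRegular

variable [TopologicalSpace 𝒳]

theorem exists_of_bound (h : IsOrderRegular P 𝒳) {f : Ω → ℝ} (hf : AEStronglyMeasurable f P)
    (M : ℝ) (hM : ∀ᵐ ω ∂P, |f ω| ≤ M) : ∃ Y : 𝒳, ∀ᵐ ω ∂P, (Y : LZero P) ω = f ω := by
  refine ⟨⟨AEEqFun.mk f hf, h.bounded_mem _ M ?_⟩, AEEqFun.coeFn_mk f hf⟩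
  filter_upwards [hM, AEEqFun.coeFn_mk f hf] with ω h1 h2
  rwa [h2]

theorem exists_max_zero (h : IsOrderRegular P 𝒳) (X : 𝒳) :
    ∃ Y : 𝒳, ∀ᵐ ω ∂P, (Y : LZero P) ω = max ((X : LZero P) ω) 0 := by
  refine ⟨(1 / 2 : ℝ) • (X + ⟨|(X : LZero P)|, h.abs_mem _ X.2⟩), ?_⟩
  filter_upwards [coeFn_smul_ae (1 / 2 : ℝ) (X + ⟨|(X : LZero P)|, h.abs_mem _ X.2⟩),
    coeFn_add_ae X ⟨|(X : LZero P)|, h.abs_mem _ X.2⟩, AEEqFun.coeFn_abs (X : LZero P)]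
    with ω h1 h2 h3
  rw [h1, h2, h3]
  rcases le_total ((X : LZero P) ω) 0 with h4 | h4
  · rw [abs_of_nonpos h4, max_eq_right h4]; ring
  · rw [abs_of_nonneg h4, max_eq_left h4]; ring

theorem exists_indicator (h : IsOrderRegular P 𝒳) {A : Set Ω} (hA : MeasurableSet A) (X : 𝒳) :
    ∃ Y : 𝒳, ∀ᵐ ω ∂P, (Y : LZero P) ω = A.indicator (X : LZero P) ω :=
  let ⟨Y, hY, hYX⟩ := h.localization A hA X X.2
  ⟨⟨Y, hY⟩, hYX⟩

/-- Bounded almost sure convergence implies convergence in the ambient space. -/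
theorem tendsto_of_bounded (h : IsOrderRegular P 𝒳) (Y : ℕ → 𝒳) (Z : 𝒳) (M : ℝ)
    (hM : ∀ᵐ ω ∂P, ∀ n, |(Y n : LZero P) ω - (Z : LZero P) ω| ≤ M)
    (hY : ∀ᵐ ω ∂P, Tendsto (fun n => (Y n : LZero P) ω) atTop (𝓝 ((Z : LZero P) ω))) :
    Tendsto Y atTop (𝓝 Z) := by
  -- The tail supremum is the least decreasing envelope of the errors; the bound `M` puts it in `𝒳`.
  let w : ℕ → Ω → ℝ := fun n ω => ⨆ k, |(Y (n + k) : LZero P) ω - (Z : LZero P) ω|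
  have hw : ∀ n, AEStronglyMeasurable (w n) P := fun n =>
    (Measurable.iSup fun k =>
      ((Y (n + k) : LZero P).measurable.sub (Z : LZero P).measurable).abs).aestronglyMeasurable
  have hbdd : ∀ ω, (∀ n, |(Y n : LZero P) ω - (Z : LZero P) ω| ≤ M) → ∀ n,
      BddAbove (range fun k => |(Y (n + k) : LZero P) ω - (Z : LZero P) ω|) := by
    rintro ω hω n
    exact ⟨M, by rintro _ ⟨k, rfl⟩; exact hω _⟩
  have hw0 : ∀ n ω, 0 ≤ w n ω := fun n ω => Real.iSup_nonneg fun k => abs_nonneg _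
  have hex : ∀ n, ∃ W : 𝒳, ∀ᵐ ω ∂P, (W : LZero P) ω = w n ω := fun n =>
    h.exists_of_bound (hw n) M (by
      filter_upwards [hM] with ω h1
      rw [abs_of_nonneg (hw0 n ω)]
      exact ciSup_le fun k => h1 _)
  choose W hW using hex
  have hW' : ∀ᵐ ω ∂P, ∀ n, (W n : LZero P) ω = w n ω := ae_all_iff.2 hW
  refine h.tendsto_of_dominated Y Z W ?_ ?_ ?_
  · filter_upwards [hW', hM] with ω h1 h2 m n hmn
    simp only [h1]
    refine ciSup_le fun k => ?_
    have := le_ciSup (hbdd ω h2 m) (n - m + k)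
    rwa [show m + (n - m + k) = n + k by omega] at this
  · filter_upwards [hW', hY] with ω h1 h2
    simp only [h1]
    rw [Metric.tendsto_atTop] at h2 ⊢
    intro ε hε
    obtain ⟨N, hN⟩ := h2 (ε / 2) (by positivity)
    refine ⟨N, fun n hn => ?_⟩
    rw [Real.dist_eq, sub_zero, abs_of_nonneg (hw0 n ω)]
    refine lt_of_le_of_lt (ciSup_le fun k => ?_) (half_lt_self hε)
    exact (hN (n + k) (by omega)).le
  · filter_upwards [hW', hM] with ω h1 h2 n
    rw [h1]
    exact le_ciSup (hbdd ω h2 n) 0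

variable {𝒜 : Set 𝒳}

/-- If `𝒜` contains all bounded nonpositive positions supported on `C`, membership in `𝒜` does not
depend on the behaviour on `C`. -/
theorem mem_of_ae_off (h : IsOrderRegular P 𝒳) (hclosed : IsClosed 𝒜) (hconvex : Convex ℝ 𝒜)
    (hsi : IsSurplusInvariant 𝒜) {C : Set Ω} (hC : MeasurableSet C)
    (hfree : ∀ (Y : 𝒳) (M : ℝ),
      (∀ᵐ ω ∂P, (Y : LZero P) ω ≤ 0 ∧ -M ≤ (Y : LZero P) ω ∧ (ω ∉ C → (Y : LZero P) ω = 0)) → Y ∈ 𝒜)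
    {X Y : 𝒳} (hX : X ∈ 𝒜)
    (hXY : ∀ᵐ ω ∂P, ω ∉ C → (Y : LZero P) ω < 0 → (X : LZero P) ω ≤ (Y : LZero P) ω) : Y ∈ 𝒜 := by
  -- The loss of `X` off `C` is `x = 1_{Cᶜ} X⁻`, and that of `Y` on `C` is `c = 1_C Y⁻`. It suffices
  -- to accept `-x - c`.
  obtain ⟨X₁, hX₁⟩ := h.exists_max_zero (-X)
  obtain ⟨x, hx⟩ := h.exists_indicator hC.compl X₁
  obtain ⟨Y₁, hY₁⟩ := h.exists_max_zero (-Y)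
  obtain ⟨c, hc⟩ := h.exists_indicator hC Y₁
  have hx' : ∀ᵐ ω ∂P, (x : LZero P) ω = Cᶜ.indicator (fun ω => max (-(X : LZero P) ω) 0) ω := by
    filter_upwards [hx, hX₁, coeFn_neg_ae X] with ω h1 h2 h3
    rw [h3] at h2
    rw [h1]
    by_cases hω : ω ∈ C <;> simp [hω, h2]
  have hc' : ∀ᵐ ω ∂P, (c : LZero P) ω = C.indicator (fun ω => max (-(Y : LZero P) ω) 0) ω := by
    filter_upwards [hc, hY₁, coeFn_neg_ae Y] with ω h1 h2 h3
    rw [h3] at h2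
    rw [h1]
    by_cases hω : ω ∈ C <;> simp [hω, h2]
  have hx0 : ∀ᵐ ω ∂P, 0 ≤ (x : LZero P) ω := by
    filter_upwards [hx'] with ω h1
    rw [h1]
    exact indicator_nonneg (fun _ _ => le_max_right _ _) _
  have hc0 : ∀ᵐ ω ∂P, 0 ≤ (c : LZero P) ω := by
    filter_upwards [hc'] with ω h1
    rw [h1]
    exact indicator_nonneg (fun _ _ => le_max_right _ _) _
  have hxA : -x ∈ 𝒜 := by
    refine hsi.mem_of_ae hX ?_
    filter_upwards [hx', coeFn_neg_ae x] with ω h1 h2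
    rw [h2, h1]
    by_cases hω : ω ∈ Cᶜ
    · rw [indicator_of_mem hω]
      intro h3
      rcases le_total (-(X : LZero P) ω) 0 with h4 | h4
      · rw [max_eq_right h4] at h3; simp at h3
      · rw [max_eq_left h4, neg_neg]
    · rw [indicator_of_notMem hω]
      simp
  have hex : ∀ n : ℕ, ∃ t : 𝒳, ∀ᵐ ω ∂P, (t : LZero P) ω = min ((c : LZero P) ω) n := fun n =>
    h.exists_of_bound (f := fun ω => min ((c : LZero P) ω) n)
      ((c : LZero P).measurable.min measurable_const).aestronglyMeasurable n (by
        filter_upwards [hc0] with ω h1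
        rw [abs_of_nonneg (le_min h1 (by positivity))]
        exact min_le_right _ _)
  choose t ht using hex
  have htA : ∀ n : ℕ, (-((n : ℝ) + 1)) • t n ∈ 𝒜 := by
    intro n
    refine hfree _ (((n : ℝ) + 1) * n) ?_
    filter_upwards [ht n, hc0, hc', coeFn_smul_ae (-((n : ℝ) + 1)) (t n)] with ω h1 h2 h3 h4
    rw [h4, h1]
    have h5 : 0 ≤ min ((c : LZero P) ω) n := le_min h2 (by positivity)
    have h6 : min ((c : LZero P) ω) n ≤ n := min_le_right _ _
    refine ⟨by nlinarith [n.cast_nonneg (α := ℝ)], by nlinarith [n.cast_nonneg (α := ℝ)],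
      fun hω => ?_⟩
    rw [h3, indicator_of_notMem hω, min_eq_left (by positivity), mul_zero]
  -- The weight `1 / (n + 1)` on the free loss cancels its factor `n + 1`, so the combination equals
  -- `-(1 - 1 / (n + 1)) x - min(c, n)` and tends to `-x - c`.
  have hmem : ∀ n : ℕ, (1 - 1 / ((n : ℝ) + 1)) • (-x) +
      (1 / ((n : ℝ) + 1)) • ((-((n : ℝ) + 1)) • t n) ∈ 𝒜 := by
    intro n
    have h1 : 1 / ((n : ℝ) + 1) ≤ 1 := by
      rw [div_le_one (by positivity)]
      linarith [n.cast_nonneg (α := ℝ)]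
    exact hconvex hxA (htA n) (by linarith) (by positivity) (by ring)
  have hlim : -x - c ∈ 𝒜 := by
    refine hclosed.mem_of_tendsto (h.tendsto_of_dominated _ _
      (fun n : ℕ => (1 / ((n : ℝ) + 1)) • x + (c - t n)) ?_ ?_ ?_)
      (Eventually.of_forall hmem)
    all_goals
      have hW : ∀ᵐ ω ∂P, ∀ n : ℕ, (((1 / ((n : ℝ) + 1)) • x + (c - t n) : 𝒳) : LZero P) ω =
          1 / ((n : ℝ) + 1) * (x : LZero P) ω + ((c : LZero P) ω - min ((c : LZero P) ω) n) := by
        refine ae_all_iff.2 fun n => ?_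
        filter_upwards [coeFn_add_ae ((1 / ((n : ℝ) + 1)) • x) (c - t n), coeFn_sub_ae c (t n),
          coeFn_smul_ae (1 / ((n : ℝ) + 1)) x, ht n] with ω h1 h2 h3 h4
        rw [h1, h2, h3, h4]
    · filter_upwards [hW, hx0] with ω h1 h2 m n hmn
      simp only [h1]
      have h3 : (m : ℝ) ≤ n := by exact_mod_cast hmn
      gcongr
    · filter_upwards [hW] with ω h1
      simp only [h1]
      have h2 : Tendsto (fun n : ℕ => (c : LZero P) ω - min ((c : LZero P) ω) n) atTop (𝓝 0) := by
        refine tendsto_const_nhds.congr' ?_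
        filter_upwards [eventually_ge_atTop ⌈(c : LZero P) ω⌉₊] with n hn
        rw [min_eq_left (Nat.ceil_le.1 hn), sub_self]
      simpa using (tendsto_one_div_add_atTop_nhds_zero_nat.mul_const ((x : LZero P) ω)).add h2
    · have hY : ∀ᵐ ω ∂P, ∀ n : ℕ, (((1 - 1 / ((n : ℝ) + 1)) • (-x) +
          (1 / ((n : ℝ) + 1)) • ((-((n : ℝ) + 1)) • t n) : 𝒳) : LZero P) ω =
          (1 - 1 / ((n : ℝ) + 1)) * (-(x : LZero P) ω) - min ((c : LZero P) ω) n := by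
        refine ae_all_iff.2 fun n => ?_
        filter_upwards [coeFn_add_ae ((1 - 1 / ((n : ℝ) + 1)) • (-x))
          ((1 / ((n : ℝ) + 1)) • ((-((n : ℝ) + 1)) • t n)),
          coeFn_smul_ae (1 - 1 / ((n : ℝ) + 1)) (-x), coeFn_neg_ae x,
          coeFn_smul_ae (1 / ((n : ℝ) + 1)) ((-((n : ℝ) + 1)) • t n),
          coeFn_smul_ae (-((n : ℝ) + 1)) (t n), ht n] with ω h1 h2 h3 h4 h5 h6
        rw [h1, h2, h3, h4, h5, h6]
        field_simp
        ring
      filter_upwards [hW, hY, hx0, coeFn_sub_ae (-x) c, coeFn_neg_ae x] with ω h1 h2 h3 h4 h5 n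
      rw [h1, h2, h4, h5]
      have h6 : min ((c : LZero P) ω) n ≤ (c : LZero P) ω := min_le_left _ _
      have h7 : 0 ≤ 1 / ((n : ℝ) + 1) * (x : LZero P) ω := by positivity
      rw [abs_of_nonneg (by linarith)]
      linarith
  refine hsi.mem_of_ae hlim ?_
  filter_upwards [hx', hc', coeFn_sub_ae (-x) c, coeFn_neg_ae x, hXY] with ω h1 h2 h3 h4 h5 h6
  rw [h3, h4, h1, h2]
  by_cases hω : ω ∈ C
  · simp only [mem_compl_iff, hω, not_true_eq_false, not_false_eq_true, indicator_of_notMem,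
      indicator_of_mem]
    rw [max_eq_left (by linarith)]
    linarith
  · have h7 := h5 hω h6
    simp only [mem_compl_iff, hω, not_false_eq_true, indicator_of_notMem, indicator_of_mem]
    rw [max_eq_left (by linarith)]
    linarith

end IsOrderRegular

end SurplusInvariance

/-! ### Construction of the standard decomposition. -/

namespace SurplusInvariance

variable {Ω : Type*} [MeasurableSpace Ω] {P : Measure Ω} {𝒳 : Submodule ℝ (LZero P)}

/-- The losses `-X` of the nonpositive elements `X` of `𝒜`. -/
def lossSet (𝒜 : Set 𝒳) : Set (LZero P) :=
  {f | (∀ᵐ ω ∂P, 0 ≤ f ω) ∧ ∃ X ∈ 𝒜, ∀ᵐ ω ∂P, (X : LZero P) ω = -f ω}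

variable {𝒜 : Set 𝒳}

theorem exists_tight_free_split [IsProbabilityMeasure P] [TopologicalSpace 𝒳]
    (h : IsOrderRegular P 𝒳)
    (hne : 𝒜.Nonempty) (hclosed : IsClosed 𝒜) (hconvex : Convex ℝ 𝒜)
    (hsi : IsSurplusInvariant 𝒜) :
    ∃ S : Set Ω, MeasurableSet S ∧ IsTightOn (lossSet 𝒜) S ∧
      ∀ (Y : 𝒳) (M : ℝ), (∀ᵐ ω ∂P, (Y : LZero P) ω ≤ 0 ∧ -M ≤ (Y : LZero P) ω ∧
        (ω ∉ Sᶜ → (Y : LZero P) ω = 0)) → Y ∈ 𝒜 := by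
  have hzero : ∀ᵐ ω ∂P, (0 : LZero P) ω = 0 := AEEqFun.coeFn_zero
  have hT0 : (0 : LZero P) ∈ lossSet 𝒜 := by
    refine ⟨hzero.mono fun ω h => h.ge, ?_⟩
    obtain ⟨X, hX⟩ := hne
    refine ⟨0, hsi.mem_of_ae hX ?_, ?_⟩
    · filter_upwards [coeFn_zero_ae (𝒳 := 𝒳)] with ω h1 h2
      exact absurd h1 h2.ne
    · filter_upwards [coeFn_zero_ae (𝒳 := 𝒳), hzero] with ω h1 h2
      rw [h1, h2, neg_zero]
  have hTconv : Convex ℝ (lossSet 𝒜) := by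
    rintro f ⟨hf, X, hX, hXf⟩ g ⟨hg, Y, hY, hYg⟩ a b ha hb hab
    have hfg : ∀ᵐ ω ∂P, (a • f + b • g : LZero P) ω = a * f ω + b * g ω := by
      filter_upwards [AEEqFun.coeFn_add (a • f) (b • g), AEEqFun.coeFn_smul a f,
        AEEqFun.coeFn_smul b g] with ω h1 h2 h3
      rw [h1, Pi.add_apply, h2, h3]
      rfl
    refine ⟨?_, a • X + b • Y, hconvex hX hY ha hb hab, ?_⟩
    · filter_upwards [hfg, hf, hg] with ω h1 h2 h3
      rw [h1]
      positivity
    · filter_upwards [hfg, hXf, hYg, coeFn_add_ae (a • X) (b • Y), coeFn_smul_ae a X,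
        coeFn_smul_ae b Y] with ω h1 h2 h3 h4 h5 h6
      rw [h4, h5, h6, h1, h2, h3]
      ring
  have hTsolid : ∀ f ∈ lossSet 𝒜, ∀ (g : LZero P) (M : ℝ),
      (∀ᵐ ω ∂P, 0 ≤ g ω ∧ g ω ≤ f ω ∧ g ω ≤ M) → g ∈ lossSet 𝒜 := by
    rintro f ⟨hf, X, hX, hXf⟩ g M hg
    obtain ⟨Y, hY⟩ := h.exists_of_bound (f := fun ω => -g ω)
      g.measurable.neg.aestronglyMeasurable M (by
        filter_upwards [hg] with ω h1
        rw [abs_neg, abs_of_nonneg h1.1]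
        exact h1.2.2)
    refine ⟨hg.mono fun ω h => h.1, Y, hsi.mem_of_ae hX ?_, hY⟩
    filter_upwards [hXf, hg, hY] with ω h1 h2 h3 _
    rw [h1, h3]
    linarith
  have hTclosed : ∀ u : ℕ → LZero P, (∀ n, u n ∈ lossSet 𝒜) → ∀ M : ℝ,
      (∀ n, ∀ᵐ ω ∂P, u n ω ≤ M) → ∀ f : LZero P,
      (∀ᵐ ω ∂P, Tendsto (fun n => u n ω) atTop (𝓝 (f ω))) → f ∈ lossSet 𝒜 := by
    intro u hu M hM f hf
    have hM' := ae_all_iff.2 hM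
    have hu0 : ∀ᵐ ω ∂P, ∀ n, 0 ≤ u n ω := ae_all_iff.2 fun n => (hu n).1
    choose X hX hXu using fun n => (hu n).2
    have hXu' := ae_all_iff.2 hXu
    have hf0 : ∀ᵐ ω ∂P, 0 ≤ f ω ∧ f ω ≤ M := by
      filter_upwards [hf, hM', hu0] with ω h1 h2 h3
      exact ⟨ge_of_tendsto' h1 h3, le_of_tendsto' h1 h2⟩
    obtain ⟨Y, hY⟩ := h.exists_of_bound (f := fun ω => -f ω)
      f.measurable.neg.aestronglyMeasurable M (by
        filter_upwards [hf0] with ω h1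
        rw [abs_neg, abs_of_nonneg h1.1]
        exact h1.2)
    refine ⟨hf0.mono fun ω h => h.1, Y, ?_, hY⟩
    refine hclosed.mem_of_tendsto (h.tendsto_of_bounded X Y M ?_ ?_) (Eventually.of_forall hX)
    · filter_upwards [hXu', hY, hf0, hM', hu0] with ω h1 h2 h3 h4 h5 n
      rw [h1, h2, abs_le]
      constructor <;> linarith [h4 n, h5 n]
    · filter_upwards [hXu', hY, hf] with ω h1 h2 h3
      simp only [h1, h2]
      exact h3.neg
  obtain ⟨S, hS, hSt, hfree⟩ := exists_isTightOn_and_compl hT0 hTconv (fun f hf => hf.1)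
    hTsolid hTclosed
  refine ⟨S, hS, hSt, fun Y M hY => ?_⟩
  obtain ⟨-, X, hX, hXY⟩ := hfree (-(Y : LZero P)) M (by
    filter_upwards [hY, AEEqFun.coeFn_neg (Y : LZero P)] with ω h1 h2
    rw [h2, Pi.neg_apply]
    refine ⟨by linarith, by linarith, fun hω => ?_⟩
    rw [h1.2.2 (by simpa using hω), neg_zero])
  refine hsi.mem_of_ae hX ?_
  filter_upwards [hXY, AEEqFun.coeFn_neg (Y : LZero P)] with ω h1 h2 _
  rw [h1, h2, Pi.neg_apply, neg_neg]

/-- There is a largest set on which the elements of `D` charge every nonnull measurable subset. -/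
theorem exists_maximal_sensitive [IsProbabilityMeasure P] (D : Set 𝒳) :
    ∃ S : Set Ω, MeasurableSet S ∧
      (∀ E, MeasurableSet E → E ⊆ S → 0 < P E → ∃ X ∈ D, 0 < P (E ∩ {ω | (X : LZero P) ω < 0})) ∧
      ∀ X ∈ D, ∀ᵐ ω ∂P, (X : LZero P) ω < 0 → ω ∈ S := by
  have hunion : ∀ s : ℕ → Set Ω, (∀ n, s n ∈ {S | MeasurableSet S ∧ ∀ E, MeasurableSet E →
      E ⊆ S → 0 < P E → ∃ X ∈ D, 0 < P (E ∩ {ω | (X : LZero P) ω < 0})}) →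
      ∀ E, MeasurableSet E → E ⊆ ⋃ n, s n → 0 < P E →
        ∃ X ∈ D, 0 < P (E ∩ {ω | (X : LZero P) ω < 0}) := by
    intro s hs E hE hEs hP
    have : ∃ n, 0 < P (E ∩ s n) := by
      by_contra! hn
      have h2 : P (⋃ n, E ∩ s n) = 0 := measure_iUnion_null fun n => le_antisymm (hn n) zero_le
      rw [← inter_iUnion, inter_eq_left.2 hEs] at h2
      exact hP.ne' h2
    obtain ⟨n, hn⟩ := this
    obtain ⟨X, hX, hXP⟩ := (hs n).2 (E ∩ s n) (hE.inter (hs n).1) inter_subset_right hn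
    exact ⟨X, hX, hXP.trans_le (measure_mono (inter_subset_inter_left _ inter_subset_left))⟩
  obtain ⟨S, ⟨hS, hSs⟩, hmax⟩ := exists_maximal_of_iUnion_mem (P := P)
    {S | MeasurableSet S ∧ ∀ E, MeasurableSet E → E ⊆ S → 0 < P E →
      ∃ X ∈ D, 0 < P (E ∩ {ω | (X : LZero P) ω < 0})}
    ⟨∅, MeasurableSet.empty, fun E _ hE hP => by
      rw [subset_empty_iff.1 hE, measure_empty] at hP; exact absurd hP (lt_irrefl _)⟩
    (fun S hS => hS.1) (fun s hs => ⟨MeasurableSet.iUnion fun n => (hs n).1, hunion s hs⟩)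
  refine ⟨S, hS, hSs, fun X hX => ?_⟩
  -- The set `{X < 0}` is itself sensitive, with `X` as witness for all its subsets, so maximality
  -- of `S` absorbs it.
  have h1 := hmax {ω | (X : LZero P) ω < 0}
    ⟨measurableSet_lt (X : LZero P).measurable measurable_const, fun E _ hE hP => ⟨X, hX, by
      rwa [inter_eq_left.2 hE]⟩⟩
  filter_upwards [measure_eq_zero_iff_ae_notMem.1 h1] with ω h2 h3
  by_contra h4
  exact h2 ⟨h3, h4⟩

theorem isTight_of_isTightOn [IsProbabilityMeasure P] {S : Set Ω}
    (ht : IsTightOn (lossSet 𝒜) S) : IsTight (𝒜 ∩ negLocalSpace 𝒳 S) := by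
  intro ε hε0 hε1
  -- Halving `1 - ε` yields the strict inequality required by `IsTight`.
  obtain ⟨M, hM, hMt⟩ := ht (ENNReal.ofReal ((1 - ε) / 2)) (by simpa using hε1)
  refine ⟨M, hM, fun X hX => ?_⟩
  have hXneg := mem_negLocalSpace_iff.1 hX.2
  have hf := hMt (-(X : LZero P)) ⟨by
    filter_upwards [hXneg, AEEqFun.coeFn_neg (X : LZero P)] with ω h1 h2
    rw [h2, Pi.neg_apply]
    linarith, X, hX.1, by
    filter_upwards [AEEqFun.coeFn_neg (X : LZero P)] with ω h2
    rw [h2, Pi.neg_apply, neg_neg]⟩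
  have hm : MeasurableSet {ω | -M < (X : LZero P) ω ∧ (X : LZero P) ω < M} :=
    (measurableSet_lt measurable_const (X : LZero P).measurable).inter
      (measurableSet_lt (X : LZero P).measurable measurable_const)
  have hcompl : P {ω | -M < (X : LZero P) ω ∧ (X : LZero P) ω < M}ᶜ ≤
      ENNReal.ofReal ((1 - ε) / 2) := by
    refine (measure_mono_ae ?_).trans hf
    filter_upwards [hXneg, AEEqFun.coeFn_neg (X : LZero P)] with ω h1 h2 h3
    have h4 : ¬ (-M < (X : LZero P) ω) := fun h => h3 ⟨h, by linarith [h1.1]⟩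
    refine ⟨?_, ?_⟩
    · by_contra hω
      rw [h1.2 hω] at h4
      exact h4 (by linarith)
    · change M ≤ _
      rw [h2, Pi.neg_apply]
      linarith
  have h5 : P.real {ω | -M < (X : LZero P) ω ∧ (X : LZero P) ω < M}ᶜ ≤ (1 - ε) / 2 :=
    ENNReal.toReal_le_of_le_ofReal (by linarith) hcompl
  rw [probReal_compl_eq_one_sub hm] at h5
  linarith

theorem exists_isStandardDecomposition [IsProbabilityMeasure P] [TopologicalSpace 𝒳]
    (h : IsOrderRegular P 𝒳)
    (hacc : IsAcceptanceSet 𝒜) (hclosed : IsClosed 𝒜) (hconvex : Convex ℝ 𝒜)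
    (hsi : IsSurplusInvariant 𝒜) :
    ∃ (A B C : Set Ω) (D : Set 𝒳), IsStandardDecomposition 𝒜 A B C D := by
  obtain ⟨S, hS, hSt, hfree⟩ := exists_tight_free_split h hacc.nonempty hclosed hconvex hsi
  obtain ⟨U, hU, hUs, hUmax⟩ := exists_maximal_sensitive (𝒜 ∩ {X : 𝒳 | (X : LZero P) ≤ 0})
  set B := S ∩ U with hBdef
  have hB : MeasurableSet B := hS.inter hU
  have hoff := fun {X Y : 𝒳} => h.mem_of_ae_off (X := X) (Y := Y) hclosed hconvex hsi hS.compl hfree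
  -- restricting to a measurable set the negative part of an acceptable position
  have hrestr : ∀ X ∈ 𝒜, ∀ E : Set Ω, MeasurableSet E → ∃ Y ∈ 𝒜, ∀ᵐ ω ∂P,
      (Y : LZero P) ω = E.indicator (fun ω => min ((X : LZero P) ω) 0) ω := by
    intro X hX E hE
    obtain ⟨X₁, hX₁⟩ := h.exists_max_zero (-X)
    obtain ⟨Y, hY⟩ := h.exists_indicator hE (-X₁)
    have hYE : ∀ᵐ ω ∂P, (Y : LZero P) ω = E.indicator (fun ω => min ((X : LZero P) ω) 0) ω := by
      filter_upwards [hX₁, hY, coeFn_neg_ae X, coeFn_neg_ae X₁] with ω h1 h2 h3 h4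
      rw [h2]
      by_cases hω : ω ∈ E
      · simp only [indicator_of_mem hω, h4, h1, h3]
        rw [← neg_zero, ← min_neg_neg]; simp
      · simp [hω]
    refine ⟨Y, hsi.mem_of_ae hX ?_, hYE⟩
    filter_upwards [hYE] with ω h1 h2
    rw [h1] at h2 ⊢
    by_cases hω : ω ∈ E
    · simp only [indicator_of_mem hω] at h2 ⊢
      rcases min_lt_iff.1 h2 with h3 | h3
      · rw [min_eq_left h3.le]
      · exact absurd h3 (lt_irrefl _)
    · simp [hω] at h2
  have hsum : 𝒜 = posLocalSpace 𝒳 (S ∩ Uᶜ) + (posLocalSpace 𝒳 B + (𝒜 ∩ negLocalSpace 𝒳 B)) +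
      localSpace 𝒳 Sᶜ := by
    ext X
    constructor
    · intro hX
      obtain ⟨a, ha⟩ := h.exists_indicator (hS.inter hU.compl) X
      obtain ⟨c, hc⟩ := h.exists_indicator hS.compl X
      obtain ⟨X₁, hX₁⟩ := h.exists_max_zero X
      obtain ⟨b, hb⟩ := h.exists_indicator hB X₁
      obtain ⟨d, hdA, hd⟩ := hrestr X hX B hB
      obtain ⟨n, hnA, hn⟩ := hrestr X hX univ MeasurableSet.univ
      have hb' : ∀ᵐ ω ∂P, (b : LZero P) ω = B.indicator (fun ω => max ((X : LZero P) ω) 0) ω := by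
        filter_upwards [hb, hX₁] with ω h1 h2
        rw [h1]
        by_cases hω : ω ∈ B <;> simp [hω, h2]
      -- The negative part of `X` is acceptable and hence charges only `U`; therefore `X ≥ 0` on `S
      -- \ U`.
      have hXU : ∀ᵐ ω ∂P, (X : LZero P) ω < 0 → ω ∈ U := by
        have h0 : (n : LZero P) ≤ 0 := by
          refine AEEqFun.coeFn_le.1 ?_
          filter_upwards [hn, AEEqFun.coeFn_zero (α := Ω) (β := ℝ) (μ := P)] with ω h1 h2
          rw [h1, h2, indicator_univ]
          exact min_le_right _ _
        filter_upwards [hUmax n ⟨hnA, h0⟩, hn] with ω h1 h2 h3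
        refine h1 ?_
        rw [h2, indicator_univ]
        exact min_lt_of_left_lt h3
      refine ⟨a + (b + d), ⟨a, ⟨⟨X, ha⟩, AEEqFun.coeFn_le.1 ?_⟩, b + d, ⟨b, ⟨⟨X₁, hb⟩,
        AEEqFun.coeFn_le.1 ?_⟩, d, ⟨hdA, mem_negLocalSpace_iff.2 ?_⟩, rfl⟩, rfl⟩, c,
        ⟨X, hc⟩, ext_ae ?_⟩
      · filter_upwards [ha, hXU, AEEqFun.coeFn_zero (α := Ω) (β := ℝ) (μ := P)] with ω h1 h2 h3
        rw [h1, h3]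
        refine indicator_apply_nonneg fun h4 => ?_
        by_contra! h5
        exact h4.2 (h2 h5)
      · filter_upwards [hb', AEEqFun.coeFn_zero (α := Ω) (β := ℝ) (μ := P)] with ω h1 h3
        rw [h1, h3]
        exact indicator_nonneg (fun _ _ => le_max_right _ _) _
      · filter_upwards [hd] with ω h1
        rw [h1]
        exact ⟨indicator_apply_nonpos fun _ => min_le_right _ _,
          fun hω => indicator_of_notMem hω _⟩
      · filter_upwards [ha, hb', hc, hd, coeFn_add_ae (a + (b + d)) c, coeFn_add_ae a (b + d),
          coeFn_add_ae b d] with ω h1 h2 h3 h4 h5 h6 h7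
        rw [h5, h6, h7, h1, h2, h3, h4]
        by_cases hωS : ω ∈ S <;> by_cases hωU : ω ∈ U <;>
          simp [hBdef, hωS, hωU, max_add_min]
    · rintro ⟨_, ⟨a, ha, _, ⟨b, hb, d, hd, rfl⟩, rfl⟩, c, ⟨c', hc⟩, rfl⟩
      -- On `S` the sum dominates the acceptable `d`; on `Sᶜ` its values do not matter.
      refine hoff hd.1 ?_
      filter_upwards [AEEqFun.coeFn_le.2 ha.2, AEEqFun.coeFn_le.2 hb.2, hc,
        AEEqFun.coeFn_zero (α := Ω) (β := ℝ) (μ := P), coeFn_add_ae (a + (b + d)) c,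
        coeFn_add_ae a (b + d), coeFn_add_ae b d] with ω h1 h2 h3 h4 h5 h6 h7 hω _
      rw [h4] at h1 h2
      rw [h5, h6, h7, h3, indicator_of_notMem hω]
      simp only [Pi.zero_apply] at h1 h2
      linarith
  refine ⟨S ∩ Uᶜ, B, Sᶜ, 𝒜 ∩ negLocalSpace 𝒳 B, ?_⟩
  refine ⟨hS.inter hU.compl, hB, hS.compl, ?_, ?_, ?_, ?_, ?_, inter_subset_right,
    hclosed.inter (h.isClosed_negLocalSpace B hB), ?_, ?_, ?_, ?_, hsum⟩
  · exact disjoint_left.2 fun ω h1 h2 => h1.2 h2.2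
  · exact disjoint_left.2 fun ω h1 h2 => h2 h1.1
  · exact disjoint_left.2 fun ω h1 h2 => h2 h1.1
  · ext ω
    simp only [hBdef, mem_union, mem_inter_iff, mem_compl_iff, mem_univ, iff_true]
    tauto
  -- If `Sᶜ` had full measure, every position would be acceptable.
  · refine lt_of_le_of_ne prob_le_one fun h1 => hacc.strict (eq_univ_of_forall fun Y => ?_)
    obtain ⟨X, hX⟩ := hacc.nonempty
    refine hoff hX ?_
    have h2 : ∀ᵐ ω ∂P, ω ∈ Sᶜ := (mem_ae_iff_prob_eq_one hS.compl).2 h1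
    filter_upwards [h2] with ω h3 h4
    exact absurd h3 h4
  · refine hconvex.inter ?_
    intro X hX Y hY a b ha hb hab
    refine mem_negLocalSpace_iff.2 ?_
    filter_upwards [mem_negLocalSpace_iff.1 hX, mem_negLocalSpace_iff.1 hY,
      coeFn_add_ae (a • X) (b • Y), coeFn_smul_ae a X, coeFn_smul_ae b Y] with ω h1 h2 h3 h4 h5
    rw [h3, h4, h5]
    refine ⟨add_nonpos (mul_nonpos_of_nonneg_of_nonpos ha h1.1)
      (mul_nonpos_of_nonneg_of_nonpos hb h2.1), fun hω => ?_⟩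
    rw [h1.2 hω, h2.2 hω, mul_zero, mul_zero, add_zero]
  · intro X hX Y hXY hY0
    refine ⟨hacc.monotone X hX.1 Y hXY, mem_negLocalSpace_iff.2 ?_⟩
    filter_upwards [mem_negLocalSpace_iff.1 hX.2, AEEqFun.coeFn_le.2 hXY, AEEqFun.coeFn_le.2 hY0,
      AEEqFun.coeFn_zero (α := Ω) (β := ℝ) (μ := P)] with ω h1 h2 h3 h4
    rw [h4] at h3
    exact ⟨h3, fun hω => le_antisymm h3 ((h1.2 hω).symm.le.trans h2)⟩
  · intro ε h0 h1
    obtain ⟨M, hM, H⟩ := isTight_of_isTightOn hSt ε h0 h1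
    refine ⟨M, hM, fun X hX => H X ⟨hX.1, mem_negLocalSpace_iff.2 ?_⟩⟩
    filter_upwards [mem_negLocalSpace_iff.1 hX.2] with ω h2
    exact ⟨h2.1, fun hω => h2.2 fun h3 => hω h3.1⟩
  · intro E hE hEB hP
    obtain ⟨X, hX, hXP⟩ := hUs E hE (hEB.trans inter_subset_right) hP
    obtain ⟨Y, hYA, hY⟩ := hrestr X hX.1 B hB
    refine ⟨Y, ⟨hYA, mem_negLocalSpace_iff.2 ?_⟩, hXP.trans_le (measure_mono_ae ?_)⟩
    · filter_upwards [hY] with ω h1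
      rw [h1]
      exact ⟨indicator_apply_nonpos fun _ => min_le_right _ _,
        fun hω => indicator_of_notMem hω _⟩
    · filter_upwards [hY] with ω h1 h2
      change E.indicator _ ω < 0
      rw [indicator_of_mem h2.1, h1, indicator_of_mem (hEB h2.1)]
      exact min_lt_of_left_lt h2.2

end SurplusInvariance

/-! ### Value-at-Risk and Expected Shortfall. -/

namespace SurplusInvariance

variable {Ω : Type*} [MeasurableSpace Ω] {P : Measure Ω}

/-- Real `sInf` defaults to `0` on empty or unbounded-below sets, so comparing values of VaR needs
this bound and `nonempty_valueAtRisk`. It comes from `P(X ≥ n) → 0`. -/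
theorem bddBelow_valueAtRisk [IsProbabilityMeasure P] {α : ℝ} (hα : α < 1) {X : Ω → ℝ}
    (hX : AEMeasurable X P) : BddBelow {t : ℝ | P.real {ω | X ω + t < 0} ≤ α} := by
  have h : Tendsto (fun n : ℕ => P {ω | (n : ℝ) ≤ X ω}) atTop (𝓝 0) := by
    have := tendsto_measure_iInter_atTop (μ := P) (s := fun n : ℕ => {ω | (n : ℝ) ≤ X ω})
      (fun n => nullMeasurableSet_le aemeasurable_const hX)
      (fun m n hmn ω (hω : (n : ℝ) ≤ X ω) => le_trans (by exact_mod_cast hmn) hω)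
      ⟨0, measure_ne_top _ _⟩
    rwa [show (⋂ n : ℕ, {ω | (n : ℝ) ≤ X ω}) = ∅ from ?_, measure_empty] at this
    refine eq_empty_of_forall_notMem fun ω hω => ?_
    obtain ⟨n, hn⟩ := exists_nat_gt (X ω)
    exact absurd (mem_iInter.1 hω n) (not_le.2 hn)
  obtain ⟨n, hn⟩ := (h.eventually_lt_const
    (show (0 : ℝ≥0∞) < ENNReal.ofReal (1 - α) by simpa using hα)).exists
  refine ⟨-n, fun t ht => ?_⟩
  by_contra! hlt
  have h1 : P.real {ω | (n : ℝ) ≤ X ω} < 1 - α :=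
    (ENNReal.lt_ofReal_iff_toReal_lt (measure_ne_top _ _)).1 hn
  have h2 : P.real (univ : Set Ω) ≤ P.real {ω | X ω + t < 0} + P.real {ω | (n : ℝ) ≤ X ω} := by
    refine (measureReal_mono fun ω _ => ?_).trans (measureReal_union_le _ _)
    by_cases hω : (n : ℝ) ≤ X ω
    · exact Or.inr hω
    · exact Or.inl (show X ω + t < 0 by linarith)
  have h3 : P.real {ω | X ω + t < 0} ≤ α := ht
  rw [probReal_univ] at h2
  linarith

theorem nonempty_valueAtRisk [IsProbabilityMeasure P] {α : ℝ} (hα : 0 < α) {X : Ω → ℝ}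
    (hX : AEMeasurable X P) : {t : ℝ | P.real {ω | X ω + t < 0} ≤ α}.Nonempty := by
  have h : Tendsto (fun n : ℕ => P {ω | X ω + n < 0}) atTop (𝓝 0) := by
    have := tendsto_measure_iInter_atTop (μ := P) (s := fun n : ℕ => {ω | X ω + n < 0})
      (fun n => nullMeasurableSet_lt (hX.add_const _) aemeasurable_const)
      (fun m n hmn ω (hω : X ω + n < 0) => by
        have : (m : ℝ) ≤ n := by exact_mod_cast hmn
        exact (show X ω + m < 0 by linarith))
      ⟨0, measure_ne_top _ _⟩
    rwa [show (⋂ n : ℕ, {ω | X ω + n < 0}) = ∅ from ?_, measure_empty] at this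
    refine eq_empty_of_forall_notMem fun ω hω => ?_
    obtain ⟨n, hn⟩ := exists_nat_gt (-X ω)
    have : X ω + n < 0 := mem_iInter.1 hω n
    linarith
  obtain ⟨n, hn⟩ := (h.eventually_lt_const
    (show (0 : ℝ≥0∞) < ENNReal.ofReal α by simpa using hα)).exists
  exact ⟨n, ((ENNReal.lt_ofReal_iff_toReal_lt (measure_ne_top _ _)).1 hn).le⟩

theorem valueAtRisk_le [IsProbabilityMeasure P] {α : ℝ} (hα : α < 1) {X : Ω → ℝ}
    (hX : AEMeasurable X P) {t : ℝ} (ht : P.real {ω | X ω + t < 0} ≤ α) :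
    valueAtRisk P α X ≤ t :=
  csInf_le (bddBelow_valueAtRisk hα hX) ht

theorem le_valueAtRisk [IsProbabilityMeasure P] {α : ℝ} (hα : 0 < α) {X : Ω → ℝ}
    (hX : AEMeasurable X P) {s : ℝ} (h : ∀ t < s, α < P.real {ω | X ω + t < 0}) :
    s ≤ valueAtRisk P α X :=
  le_csInf (nonempty_valueAtRisk hα hX) fun t ht => by
    by_contra! hlt
    exact absurd ht (not_le.2 (h t hlt))

theorem valueAtRisk_anti_level [IsProbabilityMeasure P] {X : Ω → ℝ} (hX : AEMeasurable X P)
    {α β : ℝ} (hα : 0 < α) (hαβ : α ≤ β) (hβ : β < 1) :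
    valueAtRisk P β X ≤ valueAtRisk P α X :=
  csInf_le_csInf (bddBelow_valueAtRisk hβ hX) (nonempty_valueAtRisk hα hX)
    fun _ ht => le_trans ht hαβ

theorem valueAtRisk_anti [IsProbabilityMeasure P] {X Y : Ω → ℝ} (hX : AEMeasurable X P)
    (hY : AEMeasurable Y P) (hXY : X ≤ᵐ[P] Y) {α : ℝ} (hα : α ∈ Ioo (0 : ℝ) 1) :
    valueAtRisk P α Y ≤ valueAtRisk P α X := by
  refine csInf_le_csInf (bddBelow_valueAtRisk hα.2 hY) (nonempty_valueAtRisk hα.1 hX)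
    fun t ht => le_trans (ENNReal.toReal_mono (measure_ne_top _ _) (measure_mono_ae ?_)) ht
  filter_upwards [hXY] with ω h1 (h2 : Y ω + t < 0)
  exact (show X ω + t < 0 by linarith)

theorem aemeasurable_valueAtRisk [IsProbabilityMeasure P] {X : Ω → ℝ} (hX : AEMeasurable X P) :
    AEMeasurable (fun β => valueAtRisk P β X) (volume.restrict (Ioo (0 : ℝ) 1)) :=
  aemeasurable_restrict_of_antitoneOn measurableSet_Ioo fun _ hα _ hβ hαβ =>
    valueAtRisk_anti_level hX hα.1 hαβ hβ.2

theorem valueAtRisk_nonneg [IsProbabilityMeasure P] {X : Ω → ℝ} (hX : AEMeasurable X P)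
    (hX0 : ∀ᵐ ω ∂P, X ω ≤ 0) {α : ℝ} (hα : α ∈ Ioo (0 : ℝ) 1) : 0 ≤ valueAtRisk P α X := by
  refine le_valueAtRisk hα.1 hX fun t ht => ?_
  have : P.real {ω | X ω + t < 0} = 1 := by
    rw [measureReal_def, measure_congr (eventuallyEq_univ.2 ?_), measure_univ, ENNReal.toReal_one]
    filter_upwards [hX0] with ω h1
    exact (show X ω + t < 0 by linarith)
  rw [this]
  exact hα.2

/-- The quantile function of a nonpositive integrable random variable is integrable. -/
theorem integrableOn_valueAtRisk [IsProbabilityMeasure P] {X : Ω → ℝ} (hX : Integrable X P)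
    (hX0 : ∀ᵐ ω ∂P, X ω ≤ 0) :
    IntegrableOn (fun β => valueAtRisk P β X) (Ioo (0 : ℝ) 1) := by
  have hXm := hX.aemeasurable
  have hmeas := aemeasurable_valueAtRisk hXm
  have hnn : 0 ≤ᵐ[volume.restrict (Ioo (0 : ℝ) 1)] fun β => valueAtRisk P β X := by
    filter_upwards [ae_restrict_mem measurableSet_Ioo] with β hβ
    exact valueAtRisk_nonneg hXm hX0 hβ
  refine ⟨hmeas.aestronglyMeasurable, ?_⟩
  rw [hasFiniteIntegral_iff_ofReal hnn, lintegral_eq_lintegral_meas_lt _ hnn hmeas]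
  have hXneg : 0 ≤ᵐ[P] fun ω => -X ω := by
    filter_upwards [hX0] with ω h1
    simpa using h1
  have hfin := (hasFiniteIntegral_iff_ofReal hXneg).1 hX.neg.2
  rw [lintegral_eq_lintegral_meas_lt _ hXneg hXm.neg] at hfin
  refine lt_of_le_of_lt (lintegral_mono fun t => ?_) hfin
  -- Layer-cake comparison: `VaR_β(X) > t` forces `β < P(-X > t)`, so the tails of the quantile
  -- function are no heavier than those of `-X`.
  calc (volume.restrict (Ioo (0 : ℝ) 1)) {β | t < valueAtRisk P β X}
      ≤ volume (Ioo (0 : ℝ) (P.real {ω | t < -X ω})) := by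
        rw [Measure.restrict_apply₀']
        · refine measure_mono ?_
          rintro β ⟨h1, h2⟩
          refine ⟨h2.1, ?_⟩
          by_contra! h3
          refine absurd h1 (not_lt.2 (valueAtRisk_le h2.2 hXm ?_))
          have hset : {ω | X ω + t < 0} = {ω | t < -X ω} := by
            ext ω
            change X ω + t < 0 ↔ t < -X ω
            constructor <;> intro h <;> linarith
          rwa [hset]
        · exact measurableSet_Ioo.nullMeasurableSet
    _ = P {ω | t < -X ω} := by
        rw [Real.volume_Ioo, sub_zero, measureReal_def, ENNReal.ofReal_toReal (measure_ne_top _ _)]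

/-- On `(0, α)` the function `VaR_β(X)` lies between the constant `VaR_α(X)` and the integrable
`VaR_β(Y)`, so `X` itself need not be assumed integrable. -/
theorem expectedShortfall_le_of_valueAtRisk_le [IsProbabilityMeasure P] {X Y : Ω → ℝ}
    (hX : AEMeasurable X P) (hY : Integrable Y P) (hY0 : ∀ᵐ ω ∂P, Y ω ≤ 0)
    (h : ∀ α ∈ Ioo (0 : ℝ) 1, valueAtRisk P α X ≤ valueAtRisk P α Y)
    {α : ℝ} (hα : α ∈ Ioo (0 : ℝ) 1) :
    HasExpectedShortfall P α X ∧ HasExpectedShortfall P α Y ∧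
      expectedShortfall P α X ≤ expectedShortfall P α Y := by
  have hsub : Ioo 0 α ⊆ Ioo (0 : ℝ) 1 := Ioo_subset_Ioo_right hα.2.le
  have hYi : IntegrableOn (fun β => valueAtRisk P β Y) (Ioo 0 α) :=
    (integrableOn_valueAtRisk hY hY0).mono_set hsub
  have hXi : IntegrableOn (fun β => valueAtRisk P β X) (Ioo 0 α) := by
    refine integrable_of_le_of_le
      (((aemeasurable_valueAtRisk hX).mono_set hsub).aestronglyMeasurable)
      (g₁ := fun _ => valueAtRisk P α X) (g₂ := fun β => valueAtRisk P β Y) ?_ ?_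
      (integrable_const _) hYi
    · filter_upwards [ae_restrict_mem measurableSet_Ioo] with β hβ
      exact valueAtRisk_anti_level hX hβ.1 hβ.2.le hα.2
    · filter_upwards [ae_restrict_mem measurableSet_Ioo] with β hβ
      exact h β (hsub hβ)
  have hY' : HasExpectedShortfall P α Y :=
    (intervalIntegrable_iff_integrableOn_Ioo_of_le hα.1.le).2 hYi
  have hX' : HasExpectedShortfall P α X :=
    (intervalIntegrable_iff_integrableOn_Ioo_of_le hα.1.le).2 hXi
  refine ⟨hX', hY', mul_le_mul_of_nonneg_left ?_ (one_div_nonneg.2 hα.1.le)⟩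
  exact intervalIntegral.integral_mono_on_of_le_Ioo hα.1.le hX' hY' fun β hβ => h β (hsub hβ)

/-! ### Dominating an antitone profile and bounding VaR over `𝒜`. -/

/-- An antitone function on `(0, 1)` is dominated by the Value-at-Risk profile of some nonpositive
random variable, provided it is bounded whenever the probabilities of nonnull events are bounded away
from zero. -/
theorem exists_valueAtRisk_ge [IsProbabilityMeasure P] (q : ℝ → ℝ)
    (hq : AntitoneOn q (Ioo (0 : ℝ) 1))
    (hbdd : ∀ δ : ℝ, 0 < δ → (∀ E, MeasurableSet E → P E ≠ 0 → δ ≤ P.real E) →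
      ∃ M, ∀ α ∈ Ioo (0 : ℝ) 1, q α ≤ M) :
    ∃ Xstar : LZero P, Xstar ≤ 0 ∧ ∀ α ∈ Ioo (0 : ℝ) 1, q α ≤ valueAtRisk P α Xstar := by
  by_cases hat : ∃ δ : ℝ, 0 < δ ∧ ∀ E, MeasurableSet E → P E ≠ 0 → δ ≤ P.real E
  · obtain ⟨δ, hδ, hE⟩ := hat
    obtain ⟨M, hM⟩ := hbdd δ hδ hE
    have hc := AEEqFun.coeFn_const Ω (μ := P) (-max M 0)
    refine ⟨AEEqFun.const Ω (-max M 0), ?_, fun α hα => (hM α hα).trans ?_⟩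
    · refine AEEqFun.coeFn_le.1 ?_
      filter_upwards [hc, AEEqFun.coeFn_zero (α := Ω) (β := ℝ) (μ := P)] with ω h1 h2
      rw [h1, h2]
      simp
    · refine (le_max_left M 0).trans (le_valueAtRisk hα.1 (AEEqFun.aemeasurable _) fun t ht => ?_)
      have : P.real {ω | (AEEqFun.const Ω (-max M 0) : LZero P) ω + t < 0} = 1 := by
        rw [measureReal_def, measure_congr (eventuallyEq_univ.2 ?_), measure_univ,
          ENNReal.toReal_one]
        filter_upwards [hc] with ω h1
        rw [h1, Function.const_apply]
        linarith
      rw [this]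
      exact hα.2
  · push Not at hat
    have hex : ∀ n : ℕ, ∃ E, MeasurableSet E ∧ P E ≠ 0 ∧ P.real E < (1 / 2) ^ n := fun n =>
      hat _ (by positivity)
    choose E hEm hE0 hEn using hex
    -- The shift pairs the loss `q(P(E n))` with the previous, larger-than-`α` event; `F 0 = univ`
    -- covers levels `α ≥ P(E 0)`.
    let F : ℕ → Set Ω := fun n => Nat.casesOn n univ fun n => E n
    have hFm : ∀ n, MeasurableSet (F n) := by
      rintro (_ | n)
      exacts [MeasurableSet.univ, hEm n]
    let c : ℕ → ℝ≥0∞ := fun n => ENNReal.ofReal (q (P.real (E n)))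
    let g : Ω → ℝ≥0∞ := fun ω => ∑' n, (F n).indicator (fun _ => c n) ω
    have hgm : Measurable g := Measurable.tsum fun n =>
      measurable_const.indicator (hFm n)
    have hsum : ∑' n, P (F n) ≠ ∞ := by
      rw [tsum_eq_zero_add' ENNReal.summable]
      refine ENNReal.add_ne_top.2 ⟨measure_ne_top _ _, ne_top_of_le_ne_top (b := ∑' n : ℕ,
        ENNReal.ofReal ((1 / 2) ^ n)) ?_ (ENNReal.tsum_le_tsum fun n => ?_)⟩
      · rw [← ENNReal.ofReal_tsum_of_nonneg (fun n => by positivity) summable_geometric_two]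
        exact ENNReal.ofReal_ne_top
      · exact (ENNReal.le_ofReal_iff_toReal_le (measure_ne_top _ _) (by positivity)).2 (hEn n).le
    -- By Borel–Cantelli almost every `ω` lies in finitely many `F n`, however fast the `c n` grow.
    have hfin : ∀ᵐ ω ∂P, g ω ≠ ∞ := by
      filter_upwards [ae_finite_setOfPred_mem hsum] with ω h1
      have : g ω = ∑ n ∈ h1.toFinset, (F n).indicator (fun _ => c n) ω := by
        refine tsum_eq_sum fun n hn => indicator_of_notMem (fun h => hn ?_) _
        exact h1.mem_toFinset.2 h
      rw [this]
      refine ENNReal.sum_ne_top.2 fun n _ => ?_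
      exact ne_top_of_le_ne_top ENNReal.ofReal_ne_top
        (indicator_le_self' (f := fun _ : Ω => c n) (fun _ _ => zero_le) ω)
    have hXm : AEStronglyMeasurable (fun ω => -(g ω).toReal) P :=
      hgm.ennreal_toReal.neg.aestronglyMeasurable
    have hX := AEEqFun.coeFn_mk _ hXm
    refine ⟨AEEqFun.mk _ hXm, ?_, fun α hα => ?_⟩
    · refine AEEqFun.coeFn_le.1 ?_
      filter_upwards [hX, AEEqFun.coeFn_zero (α := Ω) (β := ℝ) (μ := P)] with ω h1 h2
      rw [h1, h2]
      simp
    · have hlim : Tendsto (fun n : ℕ => P.real (E n)) atTop (𝓝 0) :=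
        squeeze_zero (fun n => measureReal_nonneg) (fun n => (hEn n).le)
          (tendsto_pow_atTop_nhds_zero_of_lt_one (by norm_num) (by norm_num))
      have hexn : ∃ n, P.real (E n) ≤ α := ((hlim.eventually_lt_const hα.1).exists).imp
        fun n hn => hn.le
      classical
      -- For the first `n` with `P(E n) ≤ α` one has `P(F n) > α`, while on `F n` the loss is at
      -- least `q(P(E n)) ≥ q(α)`.
      let n := Nat.find hexn
      have hn : P.real (E n) ≤ α := Nat.find_spec hexn
      have hFn : α < P.real (F n) := by
        rcases hcase : n with _ | m
        · change α < P.real univ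
          rw [probReal_univ]
          exact hα.2
        · exact not_le.1 (Nat.find_min hexn (m := m) (by change m < n; omega))
      have hpos : 0 < P.real (E n) := ENNReal.toReal_pos (hE0 n) (measure_ne_top _ _)
      refine (hq ⟨hpos, hn.trans_lt hα.2⟩ hα hn).trans ?_
      refine le_valueAtRisk hα.1 (AEEqFun.aemeasurable _) fun t ht => hFn.trans_le ?_
      refine ENNReal.toReal_mono (measure_ne_top _ _) (measure_mono_ae ?_)
      filter_upwards [hX, hfin] with ω h1 h2 h3
      have h4 : c n ≤ g ω := by
        have := ENNReal.le_tsum (f := fun n => (F n).indicator (fun _ => c n) ω) n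
        rwa [indicator_of_mem h3] at this
      have h5 : q (P.real (E n)) ≤ (g ω).toReal :=
        (ENNReal.ofReal_le_iff_le_toReal h2).1 h4
      change _ < _
      rw [h1]
      linarith

variable {𝒳 : Submodule ℝ (LZero P)} [TopologicalSpace 𝒳] {𝒜 : Set 𝒳}

/-- On `B`, every acceptable position dominates an element of `D`. -/
theorem IsStandardDecomposition.exists_le_indicator {A B C : Set Ω} {D : Set 𝒳}
    (h : IsStandardDecomposition 𝒜 A B C D) {X : 𝒳} (hX : X ∈ 𝒜) :
    ∃ d ∈ D, ((d : LZero P) : Ω → ℝ) ≤ᵐ[P] B.indicator (X : LZero P) := by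
  rw [h.eq_sum] at hX
  obtain ⟨_, ⟨a, ⟨⟨a', ha⟩, -⟩, _, ⟨b, hb, d, hd, rfl⟩, rfl⟩, c, ⟨c', hc⟩, rfl⟩ := hX
  obtain ⟨⟨d', hd'⟩, -⟩ := h.subset_neg hd
  refine ⟨d, hd, ?_⟩
  filter_upwards [ha, hc, hd', AEEqFun.coeFn_le.2 hb.2,
    AEEqFun.coeFn_zero (α := Ω) (β := ℝ) (μ := P),
    AEEqFun.coeFn_add ((a : LZero P) + ((b : LZero P) + (d : LZero P))) (c : LZero P),
    AEEqFun.coeFn_add (a : LZero P) ((b : LZero P) + (d : LZero P)),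
    AEEqFun.coeFn_add (b : LZero P) (d : LZero P)] with ω h1 h2 h3 h4 h5 h6 h7 h8
  by_cases hω : ω ∈ B
  · rw [indicator_of_mem hω]
    change (d : LZero P) ω ≤ (((a : LZero P) + ((b : LZero P) + (d : LZero P)) + (c : LZero P) :
      LZero P) : Ω → ℝ) ω
    rw [h6, Pi.add_apply, h7, Pi.add_apply, h8, Pi.add_apply, h1, h2,
      indicator_of_notMem (fun h' => disjoint_left.1 h.disjoint_AB h' hω),
      indicator_of_notMem (disjoint_left.1 h.disjoint_BC hω)]
    rw [h5, Pi.zero_apply] at h4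
    linarith
  · rw [indicator_of_notMem hω, h3, indicator_of_notMem hω]

theorem IsStandardDecomposition.exists_isVaRBound [IsProbabilityMeasure P] {A B C : Set Ω}
    {D : Set 𝒳} (h : IsStandardDecomposition 𝒜 A B C D) :
    ∃ Xstar : LZero P, Xstar ≤ 0 ∧ IsVaRBound 𝒜 B Xstar := by
  have hind : ∀ X : 𝒳, AEMeasurable (B.indicator (X : LZero P)) P := fun X =>
    ((X : LZero P).measurable.indicator h.measurable_B).aemeasurable
  have hB : ∀ α ∈ Ioo (0 : ℝ) 1, ∀ M : ℝ,
      (∀ d ∈ D, 1 - α < P.real {ω | -M < (d : LZero P) ω ∧ (d : LZero P) ω < M}) →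
      ∀ X ∈ 𝒜, valueAtRisk P α (B.indicator (X : LZero P)) ≤ M := by
    intro α hα M hM X hX
    obtain ⟨d, hd, hdX⟩ := h.exists_le_indicator hX
    refine (valueAtRisk_anti (d : LZero P).aemeasurable (hind X) hdX hα).trans
      (valueAtRisk_le hα.2 (d : LZero P).aemeasurable ?_)
    have h1 := hM d hd
    have hm : MeasurableSet {ω | (d : LZero P) ω + M < 0} :=
      measurableSet_lt ((d : LZero P).measurable.add_const _) measurable_const
    have h2 := probReal_add_probReal_compl (μ := P) hm
    have h3 : P.real {ω | -M < (d : LZero P) ω ∧ (d : LZero P) ω < M} ≤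
        P.real {ω | (d : LZero P) ω + M < 0}ᶜ := by
      refine measureReal_mono fun ω hω => ?_
      have h4 : -M < (d : LZero P) ω := hω.1
      exact fun h5 : (d : LZero P) ω + M < 0 => by linarith
    linarith
  have hne : ∀ α ∈ Ioo (0 : ℝ) 1,
      BddAbove ((fun X : 𝒳 => valueAtRisk P α (B.indicator (X : LZero P))) '' 𝒜) := by
    intro α hα
    obtain ⟨M, -, hM⟩ := h.tight (1 - α) (by linarith [hα.2]) (by linarith [hα.1])
    refine ⟨M, ?_⟩
    rintro _ ⟨X, hX, rfl⟩
    exact hB α hα M hM X hX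
  rcases 𝒜.eq_empty_or_nonempty with rfl | hA
  · exact ⟨0, le_rfl, fun X hX => absurd hX (notMem_empty X)⟩
  have hanti : AntitoneOn
      (fun α => sSup ((fun X : 𝒳 => valueAtRisk P α (B.indicator (X : LZero P))) '' 𝒜))
      (Ioo (0 : ℝ) 1) := by
    intro α hα β hβ hαβ
    refine csSup_le (hA.image _) ?_
    rintro _ ⟨X, hX, rfl⟩
    exact (valueAtRisk_anti_level (hind X) hα.1 hαβ hβ.2).trans
      (le_csSup (hne α hα) (mem_image_of_mem _ hX))
  obtain ⟨Xstar, hX0, hXs⟩ := exists_valueAtRisk_ge _ hanti fun δ hδ hE => by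
    -- The exceptional event then has probability below `δ`, hence is null, so one `M` serves all
    -- levels; the `min` keeps the tightness level in `(0, 1)`.
    obtain ⟨M, -, hM⟩ := h.tight (1 - min δ 1 / 2)
      (by linarith [min_le_right δ 1]) (by linarith [lt_min hδ one_pos])
    refine ⟨M, fun α hα => csSup_le (hA.image _) ?_⟩
    rintro _ ⟨X, hX, rfl⟩
    refine hB α hα M (fun d hd => ?_) X hX
    have h1 := hM d hd
    set G := {ω | -M < (d : LZero P) ω ∧ (d : LZero P) ω < M} with hG
    have hm : MeasurableSet G :=
      (measurableSet_lt measurable_const (d : LZero P).measurable).inter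
        (measurableSet_lt (d : LZero P).measurable measurable_const)
    have h2 := probReal_add_probReal_compl (μ := P) hm
    have h3 : P Gᶜ = 0 := by
      by_contra h4
      have := hE _ hm.compl h4
      linarith [min_le_left δ 1, lt_min hδ one_pos]
    rw [measureReal_def P Gᶜ, h3, ENNReal.toReal_zero] at h2
    linarith [hα.1]
  exact ⟨Xstar, hX0, fun X hX α hα =>
    (le_csSup (hne α hα) (mem_image_of_mem _ hX)).trans (hXs α hα)⟩

end SurplusInvariance

theorem mainTheorem6 {Ω : Type*} [MeasurableSpace Ω] (P : Measure Ω) [IsProbabilityMeasure P]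
    (𝒳 : Submodule ℝ (SurplusInvariance.LZero P)) [TopologicalSpace 𝒳]
    (h𝒳 : SurplusInvariance.IsAmbientSpace P 𝒳)
    (𝒜 : Set 𝒳) (hacc : SurplusInvariance.IsAcceptanceSet 𝒜)
    (hclosed : IsClosed 𝒜) (hconvex : Convex ℝ 𝒜)
    (hsi : SurplusInvariance.IsSurplusInvariant 𝒜) :
    (∃ (A B C : Set Ω) (D : Set 𝒳), SurplusInvariance.IsStandardDecomposition 𝒜 A B C D) ∧
    ∀ (A B C : Set Ω) (D : Set 𝒳), SurplusInvariance.IsStandardDecomposition 𝒜 A B C D →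
      (∃ Xstar : SurplusInvariance.LZero P, Xstar ≤ 0 ∧
        SurplusInvariance.IsVaRBound 𝒜 B Xstar) ∧
      (∀ Xstar : SurplusInvariance.LZero P, Xstar ≤ 0 →
        SurplusInvariance.IsVaRBound 𝒜 B Xstar → Integrable Xstar P →
        ∀ X ∈ 𝒜, ∀ α ∈ Ioo (0 : ℝ) 1,
          SurplusInvariance.HasExpectedShortfall P α (B.indicator (X : SurplusInvariance.LZero P)) ∧
          SurplusInvariance.HasExpectedShortfall P α Xstar ∧
          SurplusInvariance.expectedShortfall P α (B.indicator (X : SurplusInvariance.LZero P)) ≤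
            SurplusInvariance.expectedShortfall P α Xstar) := by
  refine ⟨SurplusInvariance.exists_isStandardDecomposition h𝒳.isOrderRegular hacc hclosed hconvex
    hsi, fun A B C D h => ⟨h.exists_isVaRBound, fun Xstar hX0 hXs hXi X hX α hα =>
      SurplusInvariance.expectedShortfall_le_of_valueAtRisk_le
        ((AEEqFun.measurable _).indicator h.measurable_B).aemeasurable hXi ?_ (hXs X hX) hα⟩⟩
  filter_upwards [AEEqFun.coeFn_le.2 hX0, AEEqFun.coeFn_zero (α := Ω) (β := ℝ) (μ := P)]
    with ω h1 h2
  rwa [h2] at h1
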